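/- **Setting.** Let $K$ be a number field with ring of integers $\mathcal O_K$, and for each place $v$ let $|\cdot|_v$ be the normalized absolute value on the completion $K_v$ (the usual modulus if $v$ is infinite, $|x|_v=(N\mathfrak p)^{-\operatorname{ord}_{\mathfrak p}(x)}$ if $v$ is the finite place of the prime $\mathfrak p$). A *rigid adelic space* over $K$ is a finite-dimensional $K$-vector space $E$ with an $\mathcal O_K$-lattice $L\subset E$ (finitely generated, spanning $E$ over $K$) and, for every infinite place $v$, a positive definite form $h_v$ on $E_v=K_v\otimes_K E$, symmetric if $v$ is real and Hermitian if $v$ is complex. Its local norms are $\|x\|_v=\sqrt{h_v(x,x)}$ for $v$ infinite and $\|x\|_v=\inf\{|\alpha|_v : \alpha\in K_v,\ x\in\alpha L_v\}$ for $v$ finite, where $L_v$ is the $\mathcal O_{K_v}$-span of $L$ in $E_v$. A subspace $F\subset E$ is a rigid adelic space with lattice $L\cap F$ and the restricted forms. If $L=\bigoplus_{i=1}^n\mathfrak a_ib_i$ with $(b_i)$ a $K$-basis of $E$ and $\mathfrak a_i$ fractional ideals, put $$H(E)=\Bigl(N\bigl(\textstyle\prod_i\mathfrak a_i\bigr)\prod_{v\mid\infty}\det\bigl(h_v(b_i,b_j)\bigr)^{e_v/2}\Bigr)^{1/[K:\mathbf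 Q]},\qquad H_r(E)=H(E)^{1/\dim E}\quad(E\neq 0),$$ with $e_v=1$ for $v$ real and $e_v=2$ for $v$ complex. The space $E$ is *unstable* if $H_r(F)<H_r(E)$ for some subspace $F\ne0$ of $E$. The *destabilizing subspace* $E_1$ of $E\neq 0$ is the largest nonzero subspace with $H_r(E_1)=\min_{0\ne F\subset E}H_r(F)$, that is, this equality holds and every nonzero subspace with the same reduced height is contained in $E_1$. The dual $E^\vee=\operatorname{Hom}_K(E,K)$ carries the lattice $L^\vee=\{\varphi:\varphi(L)\subset\mathcal O_K\}$ and, at infinite places, the operator norms. If $K$ is a CM field with complex conjugation $\bar{\ }$, the conjugate dual $\overline{E^\vee}$ is $E^\vee$ with the scalar multiplication $\alpha\star\varphi=\bar\alpha\varphi$, the same lattice $L^\vee$, and at infinite places the norms transported by $K_v\otimes\overline{E^\vee}\to K_v\otimes E^\vee$, $z\otimes\varphi\mapsto\bar z\otimes\varphi$. A *similarity* is a $K$-linear map whose localization at each place $v$ multiplies the local norm by a constant $\lambda_v>0$, with $\lambda_v=1$ for all but finitely many $v$. The pair $(E,\sigma)$ is *isodual* if $\sigma:E\to E^\vee$ is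 a similarity, and *anti-isodual* (for $K$ a CM field) if $\sigma:E\to\overline{E^\vee}$ is a similarity; put $b_\sigma(x,y)=\sigma(x)(y)$, which is a $K$-bilinear form in the first case and a sesquilinear form (antilinear in $x$, linear in $y$) in the second. An isodual $(E,\sigma)$ is of *orthogonal* (resp. *symplectic*) type if $b_\sigma$ is symmetric (resp. alternating); an anti-isodual $(E,\sigma)$ is of *unitary* (resp. *symplectic*) type if $b_\sigma$ is Hermitian (resp. skew-Hermitian). **Statement.** Let $(E,\sigma)$ be an isodual rigid adelic space of orthogonal or symplectic type over a number field $K$, or an anti-isodual rigid adelic space of unitary or symplectic type over a CM field $K$. If $E$ is unstable, then its destabilizing subspace $E_1$ is totally isotropic for $b_\sigma$, i.e. $b_\sigma(x,y)=0$ for all $x,y\in E_1$. In particular $\dim E_1\le\frac12\dim E$. -/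

import Mathlib

open scoped TensorProduct NumberField nonZeroDivisors
open NumberField NumberField.InfinitePlace.Completion IsDedekindDomain Module

noncomputable section

namespace AdelicSpace

section Norms

variable (K : Type*) [Field K] [NumberField K] (W : Type*) [AddCommGroup W] [Module K W]

/-- The data carried by an adelic space with underlying `K`-vector space `W`: an `𝓞 K`-lattice
(recorded by its underlying additive group), which determines the local norms at the finite places,
and local norms on the completions `K_v ⊗ W` at the infinite places. -/
structure AdelicData where
  lattice : AddSubgroup W
  archNorm : ∀ v : InfinitePlace K, v.Completion ⊗[K] W → ℝ

variable {K W}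

/-- The local norm at a finite place `v`: `‖x‖ = inf {|α|_v : α ∈ K_v, x ∈ α L_v}`, where
`L_v ⊆ K_v ⊗ W` is the `𝓞_v`-submodule generated by the lattice and `|·|_v` is the normalized
absolute value of `K_v` (a uniformizer has absolute value `(N𝔭)⁻¹`). -/
def AdelicData.finNorm (A : AdelicData K W) (v : HeightOneSpectrum (𝓞 K))
    (x : v.adicCompletion K ⊗[K] W) : ℝ :=
  sInf {r : ℝ | ∃ α : v.adicCompletion K, r = ‖α‖ ∧
    ∃ y ∈ Submodule.span (v.adicCompletionIntegers K)
      ((fun w : W => (1 : v.adicCompletion K) ⊗ₜ[K] w) '' (A.lattice : Set W)), x = α • y}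

/-- A similarity of adelic spaces: a `K`-linear map all of whose localizations multiply the local
norm by a positive ratio, the ratio being `1` at all but finitely many places. -/
def IsSimilarity {W' : Type*} [AddCommGroup W'] [Module K W'] (A : AdelicData K W)
    (B : AdelicData K W') (σ : W →ₗ[K] W') : Prop :=
  ∃ (ratioFin : HeightOneSpectrum (𝓞 K) → ℝ) (ratioInf : InfinitePlace K → ℝ),
    (∀ v, 0 < ratioFin v) ∧ (∀ v, 0 < ratioInf v) ∧ {v | ratioFin v ≠ 1}.Finite ∧
    (∀ v (x : v.adicCompletion K ⊗[K] W),
      B.finNorm v (σ.baseChange (v.adicCompletion K) x) = ratioFin v * A.finNorm v x) ∧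
    (∀ v (x : v.Completion ⊗[K] W),
      B.archNorm v (σ.baseChange v.Completion x) = ratioInf v * A.archNorm v x)

/-- The evaluation `K_v ⊗ W^∨ → (K_v ⊗ W)^∨`. -/
def evalAt (L : Type*) [Field L] [Algebra K L] :
    L ⊗[K] Dual K W →ₗ[L] Dual L (L ⊗[K] W) :=
  LinearMap.liftBaseChange L (Dual.baseChange L)

/-- The dual: `W^∨ = Hom_K(W, K)` with the lattice `L^∨ = {φ : φ(L) ⊆ 𝓞 K} = Hom(L, 𝓞 K)` and the
operator norms `‖φ‖ = sup_{x ≠ 0} |φ(x)|_v / ‖x‖` at the infinite places. -/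
def AdelicData.dual (A : AdelicData K W) : AdelicData K (Dual K W) where
  lattice :=
    { carrier := {φ | ∀ x ∈ A.lattice, φ x ∈ (algebraMap (𝓞 K) K).range}
      zero_mem' := fun x _ => by simp
      add_mem' := fun hφ hψ x hx => by
        rw [LinearMap.add_apply]; exact add_mem (hφ x hx) (hψ x hx)
      neg_mem' := fun hφ x hx => by
        rw [LinearMap.neg_apply]; exact neg_mem (hφ x hx) }
  archNorm v ω := sSup {r : ℝ | ∃ x : v.Completion ⊗[K] W, x ≠ 0 ∧
    r = ‖evalAt v.Completion ω x‖ / A.archNorm v x}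

end Norms

section Conjugate

variable (K : Type*) [Field K] [NumberField K] [IsCMField K]

/-- The conjugate `W̄` of a vector space `W` over a CM field: the additive group of `W` with the
twisted external law `α ⋆ w = ᾱ w`. -/
def Conj (_K W : Type*) : Type _ := W

instance (W : Type*) [AddCommGroup W] : AddCommGroup (Conj K W) := inferInstanceAs (AddCommGroup W)

/-- The twisted external law. -/
instance (W : Type*) [AddCommGroup W] [Module K W] : Module K (Conj K W) :=
  Module.compHom W (IsCMField.complexConj K : K →+* K)

/-- The identity map `W̄ → W`, which is additive and conjugate-linear. -/
def Conj.out {W : Type*} [AddCommGroup W] : Conj K W ≃+ W := AddEquiv.refl W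

theorem Conj.out_smul {W : Type*} [AddCommGroup W] [Module K W] (a : K) (w : Conj K W) :
    Conj.out K (a • w) = IsCMField.complexConj K a • Conj.out K w := rfl

/-- Complex conjugation on the completion `K_v ≃ ℂ` of a CM field at an infinite place. -/
def completionConj (v : InfinitePlace K) : v.Completion ≃+* v.Completion :=
  let e := ringEquivComplexOfIsComplex (IsTotallyComplex.isComplex v)
  (e.trans (starRingAut (R := ℂ))).trans e.symm

/-- It extends the complex conjugation of `K`. -/
theorem completionConj_algebraMap (v : InfinitePlace K) (a : K) :
    completionConj K v (algebraMap K v.Completion a) =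
      algebraMap K v.Completion (IsCMField.complexConj K a) := by
  simp only [completionConj, RingEquiv.trans_apply]
  rw [RingEquiv.symm_apply_eq]
  simp

/-- The canonical conjugate-linear bijection `K_v ⊗ W̄ → K_v ⊗ W`, `z ⊗ w ↦ z̄ ⊗ w`. -/
def conjTensor (W : Type*) [AddCommGroup W] [Module K W] (v : InfinitePlace K) :
    v.Completion ⊗[K] Conj K W →+ v.Completion ⊗[K] W :=
  TensorProduct.liftAddHom
    (AddMonoidHom.mk' (fun z => AddMonoidHom.mk' (fun w => completionConj K v z ⊗ₜ[K] Conj.out K w)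
      (fun a b => by rw [map_add, TensorProduct.tmul_add]))
      (fun a b => by ext w; simp [TensorProduct.add_tmul]))
    (fun r z w => by
      simp only [AddMonoidHom.mk'_apply]
      rw [Conj.out_smul, ← TensorProduct.smul_tmul, Algebra.smul_def, Algebra.smul_def, map_mul,
        completionConj_algebraMap])

variable {K} in
/-- The conjugate adelic space: same lattice, and at the infinite places the local norms obtained
by transport through `K_v ⊗ W̄ ≃ K_v ⊗ W`, `z ⊗ w ↦ z̄ ⊗ w`. -/
def AdelicData.conj {W : Type*} [AddCommGroup W] [Module K W] (A : AdelicData K W) :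
    AdelicData K (Conj K W) where
  lattice := A.lattice.comap (Conj.out K).toAddMonoidHom
  archNorm v x := A.archNorm v (conjTensor K W v x)

end Conjugate

section Rigid

/-- A rigid adelic space (equivalently, a Hermitian vector bundle over `Spec 𝓞 K`) with underlying
`K`-vector space `E`: an `𝓞 K`-lattice `L` in `E` and, on each completion `E_v = K_v ⊗ E` at an
infinite place, a positive definite form, symmetric if `v` is real and Hermitian if `v` is complex.
Forms are antilinear in the first and linear in the second variable, `K_v` being embedded in `ℂ`
through (the extension of) the embedding of `K` chosen for `v`; the form on the other realization
of `E_v` at a complex place is the one given by invariance under complex conjugation. At a real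
place the form is required to be real valued, so that it is a symmetric bilinear form. -/
structure RigidAdelicSpace (K E : Type*) [Field K] [NumberField K] [AddCommGroup E] [Module K E]
    [Module (𝓞 K) E] [IsScalarTower (𝓞 K) K E] where
  lattice : Submodule (𝓞 K) E
  isLattice : Submodule.IsLattice K lattice
  form : ∀ v : InfinitePlace K,
    (v.Completion ⊗[K] E) →ₛₗ[(starRingEnd ℂ).comp (extensionEmbedding v)]
      (v.Completion ⊗[K] E) →ₛₗ[extensionEmbedding v] ℂ
  form_symm : ∀ v x y, starRingEnd ℂ (form v x y) = form v y x
  form_pos : ∀ v x, x ≠ 0 → 0 < (form v x x).re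
  form_real : ∀ v : InfinitePlace K, v.IsReal → ∀ x y, (form v x y).im = 0

namespace RigidAdelicSpace

variable {K E : Type*} [Field K] [NumberField K] [AddCommGroup E] [Module K E]
  [Module (𝓞 K) E] [IsScalarTower (𝓞 K) K E]

/-- The underlying vector space is finite dimensional. -/
theorem finite (V : RigidAdelicSpace K E) : Module.Finite K E := by
  obtain ⟨S, hS⟩ := V.isLattice.fg
  refine ⟨⟨S, ?_⟩⟩
  rw [← V.isLattice.span_eq_top, ← hS, Submodule.span_span_of_tower]

/-- The lattice and the local norms `‖x‖_v = √(h_v(x, x))` at the infinite places. -/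
def toAdelicData (V : RigidAdelicSpace K E) : AdelicData K E where
  lattice := V.lattice.toAddSubgroup
  archNorm v x := √(V.form v x x).re

/-- Every vector has a nonzero integral multiple in a lattice. -/
theorem clear_denom (L : Submodule (𝓞 K) E) (hL : Submodule.span K (L : Set E) = ⊤) (x : E) :
    ∃ d : 𝓞 K, d ≠ 0 ∧ d • x ∈ L := by
  have hx : x ∈ Submodule.span K (L : Set E) := hL ▸ Submodule.mem_top
  induction hx using Submodule.span_induction with
  | mem x h => exact ⟨1, one_ne_zero, by simpa using h⟩
  | zero => exact ⟨1, one_ne_zero, by simp⟩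
  | add x y _ _ hx hy =>
    obtain ⟨c, hc, hcx⟩ := hx
    obtain ⟨d, hd, hdy⟩ := hy
    refine ⟨c * d, mul_ne_zero hc hd, ?_⟩
    rw [smul_add]
    refine add_mem ?_ ?_
    · rw [mul_comm, mul_smul]; exact L.smul_mem _ hcx
    · rw [mul_smul]; exact L.smul_mem _ hdy
  | smul a x _ hx =>
    obtain ⟨c, hc, hcx⟩ := hx
    obtain ⟨n, d, hd, rfl⟩ := IsFractionRing.div_surjective (A := 𝓞 K) a
    have hd0 : (algebraMap (𝓞 K) K d) ≠ 0 := by simpa using nonZeroDivisors.ne_zero hd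
    refine ⟨d * c, mul_ne_zero (nonZeroDivisors.ne_zero hd) hc, ?_⟩
    have : (d * c) • (algebraMap (𝓞 K) K n / algebraMap (𝓞 K) K d) • x = n • c • x := by
      simp only [← algebraMap_smul K (_ : 𝓞 K) (_ : E), smul_smul, map_mul]
      congr 1; field_simp
    rw [this]; exact L.smul_mem _ hcx

/-- The trace of a lattice on a subspace is a lattice in that subspace. -/
theorem isLattice_comap (L : Submodule (𝓞 K) E) (hL : Submodule.IsLattice K L)
    (F : Submodule K E) :
    Submodule.IsLattice K (L.comap (F.subtype.restrictScalars (𝓞 K))) where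
  fg := by
    have := isNoetherian_of_fg_of_noetherian L hL.fg
    exact Submodule.fg_of_fg_map_injective (F.subtype.restrictScalars (𝓞 K)) F.injective_subtype
      (isNoetherian_submodule.mp this _ (Submodule.map_comap_le _ _))
  span_eq_top := by
    refine eq_top_iff.mpr fun x _ => ?_
    obtain ⟨d, hd, hdx⟩ := clear_denom L hL.span_eq_top (x : E)
    have hm : d • x ∈ L.comap (F.subtype.restrictScalars (𝓞 K)) := by simpa using hdx
    have hd' : (algebraMap (𝓞 K) K d) ≠ 0 := by simpa using hd
    have := Submodule.smul_mem (Submodule.span K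
      (L.comap (F.subtype.restrictScalars (𝓞 K)) : Set F)) (algebraMap (𝓞 K) K d)⁻¹
      (Submodule.subset_span hm)
    rwa [← algebraMap_smul K d x, smul_smul, inv_mul_cancel₀ hd', one_smul] at this

/-- The restriction of the form at an infinite place to the completion of a subspace. -/
def restrictForm (V : RigidAdelicSpace K E) (F : Submodule K E) (v : InfinitePlace K) :
    (v.Completion ⊗[K] F) →ₛₗ[(starRingEnd ℂ).comp (extensionEmbedding v)]
      (v.Completion ⊗[K] F) →ₛₗ[extensionEmbedding v] ℂ :=
  ((V.form v).comp (F.subtype.baseChange v.Completion)).compl₂ (F.subtype.baseChange v.Completion)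

/-- A `K`-subspace with the induced structure: the lattice `L ∩ F` and the restricted forms. -/
def restrict (V : RigidAdelicSpace K E) (F : Submodule K E) : RigidAdelicSpace K F where
  lattice := V.lattice.comap (F.subtype.restrictScalars (𝓞 K))
  isLattice := isLattice_comap V.lattice V.isLattice F
  form := V.restrictForm F
  form_symm v _ _ := V.form_symm v _ _
  form_pos v _ hx := V.form_pos v _ fun h => hx <|
    Module.Flat.lTensor_preserves_injective_linearMap F.subtype F.injective_subtype
      (h.trans (map_zero _).symm)
  form_real v hv _ _ := V.form_real v hv _ _

/-- The determinants of families of lattice vectors have a common denominator. -/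
theorem isFractional_det (L : Submodule (𝓞 K) E) (hL : L.FG)
  {ι : Type*} [Fintype ι] [DecidableEq ι] (b : Basis ι K E) :
   IsFractional (𝓞 K)⁰ (Submodule.span (𝓞 K) {d : K | ∃ x : ι → E, (∀ i, x i ∈ L) ∧ d = b.det x}) := by
  -- a common denominator of all coordinates
  have h1 : ∃ a ∈ (𝓞 K)⁰, ∀ x ∈ L, ∀ i, IsLocalization.IsInteger (𝓞 K) (a • b.repr x i) := by
    have hfg : (⨆ i, L.map ((b.coord i).restrictScalars (𝓞 K))).FG :=
      Submodule.fg_iSup _ fun i => hL.map _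
    obtain ⟨a, ha, h⟩ := FractionalIdeal.isFractional_of_fg (S := (𝓞 K)⁰) hfg
    exact ⟨a, ha, fun x hx i => h _ (Submodule.mem_iSup_of_mem i ⟨x, hx, rfl⟩)⟩
  obtain ⟨a, ha, h⟩ := h1
  refine ⟨a ^ Fintype.card ι, pow_mem ha _, fun d hd => ?_⟩
  induction hd using Submodule.span_induction with
  | mem d hd =>
    obtain ⟨x, hx, rfl⟩ := hd
    choose n hn using fun i j => h (x j) (hx j) i
    refine ⟨(Matrix.of n).det, ?_⟩
    rw [RingHom.map_det, Basis.det_apply, ← algebraMap_smul K (a ^ _), map_pow, smul_eq_mul,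
      ← Matrix.det_smul]
    congr 1
    ext i j
    simp [hn, Basis.toMatrix_apply, Algebra.smul_def]
  | zero => simpa using IsLocalization.isInteger_zero
  | add x y _ _ hx hy => rw [smul_add]; exact IsLocalization.isInteger_add hx hy
  | smul c x _ hx => rw [smul_comm]; exact IsLocalization.isInteger_smul hx

/-- The fractional ideal of `K` generated by the determinants, with respect to a `K`-basis `b` of
`E`, of the families of elements of the lattice. If `L = ⨁ 𝔞 i • b i`, it is `∏ 𝔞 i`. -/
def detIdeal (V : RigidAdelicSpace K E) {ι : Type*} [Fintype ι] [DecidableEq ι] (b : Basis ι K E) :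
    FractionalIdeal (𝓞 K)⁰ K :=
  ⟨Submodule.span (𝓞 K) {d : K | ∃ x : ι → E, (∀ i, x i ∈ V.lattice) ∧ d = b.det x},
    isFractional_det V.lattice V.isLattice.fg b⟩

/-- The height computed in a `K`-basis `b` of `E`:
`(N(𝔞) ∏_{v ∣ ∞} det(h_v(b i, b j)) ^ (e_v / 2)) ^ (1 / [K : ℚ])`, where `𝔞` is the ideal `detIdeal`
(the product of the ideals of a pseudo-basis) and `e_v` is `1` or `2` for `v` real or complex. -/
def heightOf (V : RigidAdelicSpace K E) {ι : Type*} [Fintype ι] [DecidableEq ι] (b : Basis ι K E) :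
    ℝ :=
  ((FractionalIdeal.absNorm (V.detIdeal b) : ℝ) *
    ∏ v : InfinitePlace K,
      √(Matrix.of fun i j => V.form v (1 ⊗ₜ[K] b i) (1 ⊗ₜ[K] b j)).det.re ^ v.mult) ^
    (1 / (finrank ℚ K : ℝ))

/-- Two bases yield ideals that differ by the determinant of the change of basis. -/
theorem detIdeal_eq (V : RigidAdelicSpace K E) {ι : Type*} [Fintype ι] [DecidableEq ι]
    (b b' : Basis ι K E) :
    V.detIdeal b' = FractionalIdeal.spanSingleton (𝓞 K)⁰ (b'.det b) * V.detIdeal b := by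
  apply FractionalIdeal.coeToSubmodule_injective
  beta_reduce
  rw [FractionalIdeal.coe_mul, FractionalIdeal.coe_spanSingleton]
  change Submodule.span _ _ = _ * Submodule.span _ _
  rw [Submodule.span_mul_span]
  congr 1
  ext d
  simp only [Set.mem_ofPred_eq, Set.singleton_mul, Set.mem_image]
  have key : ∀ x : ι → E, b'.det x = b'.det b * b.det x := fun x => by
    rw [Basis.det_apply, Basis.det_apply, Basis.det_apply, ← Matrix.det_mul,
      Basis.toMatrix_mul_toMatrix]
  constructor
  · rintro ⟨x, hx, rfl⟩; exact ⟨_, ⟨x, hx, rfl⟩, (key x).symm⟩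
  · rintro ⟨_, ⟨x, hx, rfl⟩, rfl⟩; exact ⟨x, hx, (key x).symm⟩

/-- Change of basis for the Gram determinant at an infinite place. -/
theorem gram_det_eq (V : RigidAdelicSpace K E) {ι : Type*} [Fintype ι] [DecidableEq ι]
    (b b' : Basis ι K E) (v : InfinitePlace K) :
    (Matrix.of fun i j => V.form v (1 ⊗ₜ[K] b i) (1 ⊗ₜ[K] b j)).det.re = v (b'.det b) ^ 2 *
     (Matrix.of fun i j => V.form v (1 ⊗ₜ[K] b' i) (1 ⊗ₜ[K] b' j)).det.re := by
  set G := (Matrix.of fun i j => V.form v (1 ⊗ₜ[K] b' i) (1 ⊗ₜ[K] b' j)) with hG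
  set P : Matrix ι ι ℂ := (b'.toMatrix b).map v.embedding with hP
  have h1 : (Matrix.of fun i j => V.form v (1 ⊗ₜ[K] b i) (1 ⊗ₜ[K] b j)) = P.conjTranspose * G * P := by
    have hb : ∀ i, (1 : v.Completion) ⊗ₜ[K] b i =
        ∑ k, algebraMap K v.Completion (b'.toMatrix b k i) • ((1 : v.Completion) ⊗ₜ[K] b' k) := by
      intro i
      simp_rw [algebraMap_smul, ← TensorProduct.tmul_smul, ← TensorProduct.tmul_sum]
      rw [Basis.sum_toMatrix_smul_self]
    ext i j
    rw [Matrix.of_apply, hb i, hb j]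
    simp only [map_sum, LinearMap.sum_apply, map_smulₛₗ, LinearMap.smul_apply, Matrix.mul_apply,
      Matrix.conjTranspose_apply, hP, hG, Matrix.map_apply, Matrix.of_apply, Finset.sum_mul,
      smul_eq_mul, Finset.mul_sum]
    refine Finset.sum_congr rfl fun k _ => Finset.sum_congr rfl fun l _ => ?_
    simp [mul_comm]
  have h2 : P.det = v.embedding (b'.det b) := by
    rw [Basis.det_apply, RingHom.map_det]; rfl
  have h3 : star P.det * P.det = ((v (b'.det b) ^ 2 : ℝ) : ℂ) := by
    rw [h2, RCLike.star_def, Complex.conj_mul', InfinitePlace.norm_embedding_eq]; simp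
  rw [h1, Matrix.det_mul, Matrix.det_mul, Matrix.det_conjTranspose, mul_right_comm, h3,
    Complex.re_ofReal_mul]

/-- The height does not depend on the basis in which it is computed. -/
theorem heightOf_eq (V : RigidAdelicSpace K E) {ι : Type*} [Fintype ι] [DecidableEq ι]
    (b b' : Basis ι K E) : V.heightOf b = V.heightOf b' := by
  unfold heightOf
  congr 1
  rw [V.detIdeal_eq b b', map_mul, FractionalIdeal.absNorm_span_singleton]
  simp_rw [V.gram_det_eq b b']
  simp_rw [Real.sqrt_mul (sq_nonneg _), Real.sqrt_sq (apply_nonneg _ _), mul_pow]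
  rw [Finset.prod_mul_distrib, InfinitePlace.prod_eq_abs_norm]
  push_cast
  ring

open scoped Pointwise in
/-- For a pseudo-basis the ideal `detIdeal` is the product of the ideals of the pseudo-basis. -/
theorem detIdeal_pseudoBasis (V : RigidAdelicSpace K E) {ι : Type*} [Fintype ι] [DecidableEq ι]
    (b : Basis ι K E) (𝔞 : ι → FractionalIdeal (𝓞 K)⁰ K)
    (h : ∀ x, x ∈ V.lattice ↔ ∀ i, b.repr x i ∈ 𝔞 i) : V.detIdeal b = ∏ i, 𝔞 i := by
  have hprod : ((∏ i, 𝔞 i : FractionalIdeal (𝓞 K)⁰ K) : Submodule (𝓞 K) K) =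
      Submodule.span (𝓞 K) (∏ i, ((𝔞 i : Submodule (𝓞 K) K) : Set K)) := by
    rw [← Submodule.prod_span]
    simp only [Submodule.span_eq]
    exact map_prod (FractionalIdeal.coeSubmoduleHom (𝓞 K)⁰ K) 𝔞 _
  apply FractionalIdeal.coeToSubmodule_injective
  beta_reduce
  rw [hprod]
  apply le_antisymm
  · change Submodule.span _ _ ≤ _
    rw [Submodule.span_le]
    rintro _ ⟨x, hx, rfl⟩
    rw [Basis.det_apply, Matrix.det_apply]
    refine sum_mem fun s _ => ?_
    rw [Units.smul_def]
    refine zsmul_mem (Submodule.subset_span ?_) _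
    rw [← Equiv.prod_comp s (fun i => ((𝔞 i : Submodule (𝓞 K) K) : Set K))]
    exact Set.finsetProd_mem_finsetProd _ _ _ fun i _ => by
      simpa [Basis.toMatrix_apply] using (h _).1 (hx i) (s i)
  · rw [Submodule.span_le]
    intro d hd
    obtain ⟨f, hf, rfl⟩ := (Set.mem_fintype_prod _ _).1 hd
    refine Submodule.subset_span ⟨fun i => f i • b i, fun i => (h _).2 fun j => ?_, ?_⟩
    · by_cases hij : i = j
      · subst hij; simpa using! @hf i
      · simpa [hij] using (𝔞 j).zero_mem
    · rw [AlternatingMap.map_smul_univ, Basis.det_self]; simp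
/-- The height `H(E)`; it is computed in some basis, and does not depend on it. -/
def height (V : RigidAdelicSpace K E) : ℝ :=
  haveI := V.finite
  V.heightOf (finBasis K E)

/-- The reduced height `H_r(E) = H(E) ^ (1 / dim E)`; it is meaningful for `E ≠ 0`. -/
def reducedHeight (V : RigidAdelicSpace K E) : ℝ :=
  V.height ^ (1 / (finrank K E : ℝ))

/-- `E` is semistable if `H_r(F) ≥ H_r(E)` for all nonzero subspaces `F`. -/
def IsSemistable (V : RigidAdelicSpace K E) : Prop :=
  ∀ F : Submodule K E, F ≠ ⊥ → V.reducedHeight ≤ (V.restrict F).reducedHeight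

/-- `E` is unstable if it is not semistable. -/
def IsUnstable (V : RigidAdelicSpace K E) : Prop := ¬ V.IsSemistable

/-- `E₁` is the destabilizing subspace of `E`: its reduced height is the minimum of the reduced
heights of the nonzero subspaces of `E`, and it contains every nonzero subspace whose reduced height
is this minimum. (There is exactly one such subspace as soon as `E ≠ 0`.) -/
def IsDestabilizing (V : RigidAdelicSpace K E) (E₁ : Submodule K E) : Prop :=
  E₁ ≠ ⊥ ∧
  (∀ F : Submodule K E, F ≠ ⊥ → (V.restrict E₁).reducedHeight ≤ (V.restrict F).reducedHeight) ∧
  (∀ F : Submodule K E, F ≠ ⊥ → (V.restrict F).reducedHeight = (V.restrict E₁).reducedHeight →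
    F ≤ E₁)

/-- `(E, σ)` is isodual: `σ` is a similarity from `E` to its dual. -/
def IsIsodual (V : RigidAdelicSpace K E) (σ : E →ₗ[K] Dual K E) : Prop :=
  IsSimilarity V.toAdelicData V.toAdelicData.dual σ

/-- `(E, σ)` is anti-isodual: `σ` is a similarity from `E` to its conjugate dual. -/
def IsAntiIsodual [IsCMField K] (V : RigidAdelicSpace K E) (σ : E →ₗ[K] Conj K (Dual K E)) :
    Prop :=
  IsSimilarity V.toAdelicData V.toAdelicData.dual.conj σ

end RigidAdelicSpace
section Forms

/-- The bilinear form `b_σ(x, y) = σ(x)(y)` attached to `σ : E → E^∨`. -/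
def bilinForm {K E : Type*} [Field K] [AddCommGroup E] [Module K E] (σ : E →ₗ[K] Dual K E) :
    E →ₗ[K] E →ₗ[K] K := σ

/-- The form `b_σ(x, y) = σ(x)(y)` attached to a `K`-linear map `σ` from `E` to its conjugate dual:
it is sesquilinear, antilinear in `x` and linear in `y`. -/
def sesqForm {K E : Type*} [Field K] [NumberField K] [IsCMField K] [AddCommGroup E] [Module K E]
    (σ : E →ₗ[K] Conj K (Dual K E)) :
    E →ₛₗ[(IsCMField.complexConj K : K →+* K)] E →ₗ[K] K where
  toFun x := Conj.out K (σ x)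
  map_add' x y := by rw [map_add, map_add]
  map_smul' a x := by rw [map_smul, Conj.out_smul]; rfl

variable {K E : Type*} [Field K] [AddCommGroup E] [Module K E] {τ : K →+* K}

/-- Orthogonal type: the bilinear form is symmetric. -/
def IsOrthogonal (b : E →ₗ[K] E →ₗ[K] K) : Prop := ∀ x y, b x y = b y x

/-- Symplectic type, isodual case: the bilinear form is alternating. -/
def IsSymplectic (b : E →ₗ[K] E →ₗ[K] K) : Prop := ∀ x, b x x = 0

/-- Unitary type: the sesquilinear form is Hermitian (`τ` is the complex conjugation). -/
def IsUnitary (b : E →ₛₗ[τ] E →ₗ[K] K) : Prop := ∀ x y, b y x = τ (b x y)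

/-- Symplectic type, anti-isodual case: the sesquilinear form is skew-Hermitian. (This contains the
sesquilinear forms with `b x x = 0` for all `x`, which over a CM field are zero.) -/
def IsSkewUnitary (b : E →ₛₗ[τ] E →ₗ[K] K) : Prop := ∀ x y, b y x = -τ (b x y)

/-- `F` is totally isotropic: the form vanishes on `F × F`. -/
def IsTotallyIsotropic (b : E →ₛₗ[τ] E →ₗ[K] K) (F : Submodule K E) : Prop :=
  ∀ x ∈ F, ∀ y ∈ F, b x y = 0

end Forms
end Rigid
end AdelicSpace
end

/-! Let `c` be the form attached to `σ` (its complex conjugate in the CM case), `J` the fractional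
ideal generated by the values of `c` on the lattice, `lam v` the similarity ratios at the infinite
places, `Λ = ∏ lam v ^ e_v`, `d = [K : ℚ]`, and `s = log N(J) - log Λ`. The proof squeezes `s`
between the logarithms of two reduced heights, by comparing discriminants.

On all of `E`, the similarity makes `c`, divided by a local generator of `J`, unimodular at each
finite place (`exists_valuation_le_det`), and it fixes the absolute value of the discriminant at
each infinite place (`arch_bounds`). By the product formula, `2d log H_r(E) ≤ s`
(`sqHeight_le_of_similarity`).

On `E₁`, let `I` be the radical of the restricted form and suppose that `k = dim E₁/I` is positive.
The form on `E₁/I` is nondegenerate. Its discriminant ideal lies in `J ^ k`, and at `v` its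
discriminant is at most `lam v ^ k` times the determinant of the quotient metric, by Cauchy-Schwarz
and an eigenvalue estimate. The product formula, applied to this nonzero discriminant, gives `k s ≤
2d (log H(E₁) - log H(I))` (`sqHeight_le_of_radical`). Minimality of `H_r(E₁)` gives `log H(I) ≥ dim
I · log H_r(E₁)`, hence `s ≤ 2d log H_r(E₁)`.

Together `H_r(E) ≤ H_r(E₁)`, which contradicts instability; so `I = E₁`
(`isotropic_of_isDestabilizing`). Of the type of the form only reflexivity is used: it makes the
radical two-sided. The dimension bound then follows from the injectivity of `σ`. -/

noncomputable section

namespace AdelicSpace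

/-! ### Fractional ideals: local inclusion, norms, automorphisms -/

section FractionalIdeals

open scoped WithZero Pointwise

variable {K : Type*} [Field K] [NumberField K]

/-- Inclusion of fractional ideals can be checked locally. -/
theorem fractionalIdeal_le_of_valuation_le {J₁ J₂ : FractionalIdeal (𝓞 K)⁰ K}
    (h : ∀ v : HeightOneSpectrum (𝓞 K), ∀ d ∈ J₁, ∃ e ∈ J₂, v.valuation K d ≤ v.valuation K e) :
    J₁ ≤ J₂ := by
  intro d hd
  -- The ideal of multipliers sending `d` into `J₂`. Membership of `d` means that it is the unit
  -- ideal, so it suffices to find, for each maximal ideal, a multiplier outside it.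
  let c : Ideal (𝓞 K) := (J₂ : Submodule (𝓞 K) K).comap (LinearMap.toSpanSingleton (𝓞 K) K d)
  have hc : c = ⊤ := by
    by_contra hne
    obtain ⟨p, hp, hcp⟩ := Ideal.exists_le_maximal c hne
    by_cases hbot : p = ⊥
    · exact Ring.ne_bot_of_isMaximal_of_not_isField hp (RingOfIntegers.not_isField K) hbot
    · let v : HeightOneSpectrum (𝓞 K) := ⟨p, hp.isPrime, hbot⟩
      obtain ⟨e, he, hde⟩ := h v d hd
      by_cases he0 : e = 0
      · subst he0
        have hd0 : d = 0 := by simpa using hde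
        exact hne (Ideal.eq_top_iff_one _ |>.2 (by
          change (1 : 𝓞 K) • d ∈ (J₂ : Submodule (𝓞 K) K)
          rw [hd0, smul_zero]; exact zero_mem _))
      · obtain ⟨r, s, hrs⟩ := v.exists_primeCompl_mul_eq_of_integer (d / e) (by
          rw [map_div₀]
          exact div_le_one_of_le₀ hde zero_le)
        have : (s : 𝓞 K) ∈ c := by
          change (s : 𝓞 K) • d ∈ (J₂ : Submodule (𝓞 K) K)
          have : (s : 𝓞 K) • d = r • e := by
            rw [Algebra.smul_def, Algebra.smul_def, ← hrs]; field_simp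
          rw [this]; exact Submodule.smul_mem _ _ he
        exact s.2 (hcp this)
  have h1 : (1 : 𝓞 K) ∈ c := hc ▸ Submodule.mem_top
  have : (1 : 𝓞 K) • d ∈ (J₂ : Submodule (𝓞 K) K) := h1
  rwa [one_smul] at this

/-- Here `J₁ = J₂ * I` with `I` a nonzero integral ideal, of norm at least `1`. Through this
reversal, inclusions of determinant ideals become inequalities of heights: a smaller lattice has a
larger height. -/
theorem absNorm_le_of_le {J₁ J₂ : FractionalIdeal (𝓞 K)⁰ K} (h : J₁ ≤ J₂) (h0 : J₁ ≠ 0) :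
    FractionalIdeal.absNorm J₂ ≤ FractionalIdeal.absNorm J₁ := by
  have h2 : J₂ ≠ 0 := fun h' => h0 (le_antisymm (h' ▸ h) (FractionalIdeal.zero_le _))
  have hle : J₁ * J₂⁻¹ ≤ 1 := by
    rw [← mul_inv_cancel₀ h2]; exact mul_le_mul_left h _
  obtain ⟨I, hI⟩ := FractionalIdeal.le_one_iff_exists_coeIdeal.1 hle
  have hJ : J₁ = J₂ * I := by rw [hI, mul_left_comm, mul_inv_cancel₀ h2, mul_one]
  have hI0 : I ≠ ⊥ := by rintro rfl; simp [hJ] at h0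
  have h1 : (1 : ℚ) ≤ FractionalIdeal.absNorm (I : FractionalIdeal (𝓞 K)⁰ K) := by
    rw [FractionalIdeal.coeIdeal_absNorm]
    exact_mod_cast Nat.one_le_iff_ne_zero.2 (Ideal.absNorm_eq_zero_iff.not.2 hI0)
  rw [hJ, map_mul]
  exact le_mul_of_one_le_right (FractionalIdeal.absNorm_nonneg _) h1

theorem absNorm_map_ringEquiv (e : 𝓞 K ≃+* 𝓞 K) (I : Ideal (𝓞 K)) :
    Ideal.absNorm (I.map (e : 𝓞 K →+* 𝓞 K)) = Ideal.absNorm I := by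
  rw [Ideal.absNorm_apply, Ideal.absNorm_apply, Submodule.cardQuot_apply,
    Submodule.cardQuot_apply]
  exact Nat.card_congr (Ideal.quotientEquiv I _ e rfl).symm.toEquiv

/-- The norm of a fractional ideal is invariant under automorphisms of the field. -/
theorem absNorm_eq_of_ringEquiv (τ : K ≃+* K) (J J' : FractionalIdeal (𝓞 K)⁰ K)
    (h : ∀ x, τ x ∈ J' ↔ x ∈ J) : FractionalIdeal.absNorm J' = FractionalIdeal.absNorm J := by
  let e : 𝓞 K ≃+* 𝓞 K := RingOfIntegers.mapRingEquiv τ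
  have he : ∀ a : 𝓞 K, algebraMap (𝓞 K) K (e a) = τ (algebraMap (𝓞 K) K a) := fun a => rfl
  have hden : e (J.den : 𝓞 K) ∈ (𝓞 K)⁰ := by
    rw [mem_nonZeroDivisors_iff_ne_zero]
    simp
  have key := J.den_mul_self_eq_num
  rw [FractionalIdeal.absNorm_eq' ⟨e J.den, hden⟩ (J.num.map (e : 𝓞 K →+* 𝓞 K)),
    FractionalIdeal.absNorm_eq, absNorm_map_ringEquiv]
  · congr 2
    rw [Int.abs_eq_natAbs, Int.abs_eq_natAbs]
    congr 1
    rw [← Ideal.absNorm_span_singleton, ← Ideal.absNorm_span_singleton,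
      ← absNorm_map_ringEquiv e (Ideal.span {(J.den : 𝓞 K)}), Ideal.map_span, Set.image_singleton]
    rfl
  · ext x
    obtain ⟨x, rfl⟩ := τ.surjective x
    have h1 : τ x ∈ (⟨e J.den, hden⟩ : (𝓞 K)⁰) • (J' : Submodule (𝓞 K) K) ↔
        x ∈ J.den • (J : Submodule (𝓞 K) K) := by
      simp only [Submonoid.smul_def, Submodule.mem_smul_pointwise_iff_exists]
      constructor
      · rintro ⟨y, hy, hxy⟩
        obtain ⟨y, rfl⟩ := τ.surjective y
        refine ⟨y, (h y).1 hy, τ.injective ?_⟩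
        rw [← hxy, Algebra.smul_def, Algebra.smul_def, map_mul, he]
      · rintro ⟨y, hy, rfl⟩
        refine ⟨τ y, (h y).2 hy, ?_⟩
        rw [Algebra.smul_def, Algebra.smul_def, map_mul, he]
    rw [h1, key]
    simp only [Submodule.mem_map, Algebra.linearMap_apply]
    constructor
    · rintro ⟨a, ha, rfl⟩
      exact ⟨e a, Ideal.mem_map_of_mem _ ha, he a⟩
    · rintro ⟨a, ha, hax⟩
      obtain ⟨a, rfl⟩ := e.surjective a
      refine ⟨a, ?_, τ.injective hax⟩
      obtain ⟨b, hb, hba⟩ := (Ideal.mem_map_iff_of_surjective (e : 𝓞 K →+* 𝓞 K) e.surjective).1 ha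
      rwa [← e.injective hba]

omit [NumberField K] in
theorem valuation_le_of_mem_span {Γ : Type*} [LinearOrderedCommGroupWithZero Γ]
    (w : Valuation K Γ) (hw : ∀ a : 𝓞 K, w a ≤ 1) {S : Set K} {γ : Γ}
    (hS : ∀ d ∈ S, w d ≤ γ) {d : K} (hd : d ∈ Submodule.span (𝓞 K) S) : w d ≤ γ := by
  induction hd using Submodule.span_induction with
  | mem d hd => exact hS d hd
  | zero => simp
  | add x y _ _ hx hy => exact w.map_add_le hx hy
  | smul a x _ hx =>
    rw [Algebra.smul_def, map_mul]
    exact (mul_le_of_le_one_left' (hw a)).trans hx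

end FractionalIdeals

/-! ### Determinant ideals of lattices and local bases -/

section Lattices

open scoped WithZero

variable {K : Type*} [Field K] [NumberField K]
  {W : Type*} [AddCommGroup W] [Module K W] [Module (𝓞 K) W] [IsScalarTower (𝓞 K) K W]
  {ι : Type*} [Fintype ι] [DecidableEq ι]

/-- The fractional ideal generated by the determinants, in the basis `b`, of the families of
elements of a lattice. -/
def latticeDet (L : Submodule (𝓞 K) W) (hL : L.FG) (b : Basis ι K W) :
    FractionalIdeal (𝓞 K)⁰ K :=
  ⟨Submodule.span (𝓞 K) {d : K | ∃ x : ι → W, (∀ i, x i ∈ L) ∧ d = b.det x},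
    RigidAdelicSpace.isFractional_det L hL b⟩

theorem det_mem_latticeDet (L : Submodule (𝓞 K) W) (hL : L.FG) (b : Basis ι K W) (x : ι → W)
    (hx : ∀ i, x i ∈ L) : b.det x ∈ latticeDet L hL b :=
  Submodule.subset_span ⟨x, hx, rfl⟩

theorem exists_det_ne_zero (L : Submodule (𝓞 K) W) (hs : Submodule.span K (L : Set W) = ⊤)
    (b : Basis ι K W) : ∃ x : ι → W, (∀ i, x i ∈ L) ∧ b.det x ≠ 0 := by
  choose d hd hdL using fun i => RigidAdelicSpace.clear_denom L hs (b i)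
  refine ⟨fun i => d i • b i, hdL, ?_⟩
  have : (fun i => d i • b i) = fun i => (algebraMap (𝓞 K) K (d i)) • b i := by
    ext i; rw [algebraMap_smul]
  rw [this, AlternatingMap.map_smul_univ, Basis.det_self, smul_eq_mul, mul_one]
  exact Finset.prod_ne_zero_iff.2 fun i _ => by simpa using hd i

theorem latticeDet_ne_zero (L : Submodule (𝓞 K) W) (hL : L.FG)
    (hs : Submodule.span K (L : Set W) = ⊤) (b : Basis ι K W) : latticeDet L hL b ≠ 0 := by
  obtain ⟨x, hx, hx0⟩ := exists_det_ne_zero L hs b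
  intro h
  have := det_mem_latticeDet L hL b x hx
  rw [h] at this
  exact hx0 (by simpa using this)

/-- A lattice has, locally at a discrete valuation, a basis consisting of lattice elements. -/
theorem exists_local_basis (L : Submodule (𝓞 K) W) (hL : L.FG)
    (hs : Submodule.span K (L : Set W) = ⊤) (b : Basis ι K W) (w : Valuation K ℤᵐ⁰)
    (hw : ∀ a : 𝓞 K, w a ≤ 1) :
    ∃ x : Basis ι K W, (∀ i, x i ∈ L) ∧ (∀ y ∈ L, ∀ i, w (x.repr y i) ≤ 1) ∧
      ∀ d ∈ latticeDet L hL b, w d ≤ w (b.det x) := by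
  obtain ⟨a, ha, hfr⟩ := RigidAdelicSpace.isFractional_det L hL b
  have ha0 : algebraMap (𝓞 K) K a ≠ 0 := by simpa using nonZeroDivisors.ne_zero ha
  obtain ⟨x₀, hx₀, hx₀0⟩ := exists_det_ne_zero L hs b
  have hbd : ∀ y : ι → W, (∀ i, y i ∈ L) → w (b.det y) ≤ (w (algebraMap (𝓞 K) K a))⁻¹ := by
    intro y hy
    obtain ⟨c, hc⟩ := hfr (b.det y) (Submodule.subset_span ⟨y, hy, rfl⟩)
    rw [Algebra.smul_def] at hc
    have : w (algebraMap (𝓞 K) K a) * w (b.det y) ≤ 1 := by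
      rw [← map_mul, ← hc]; exact hw c
    rwa [← one_div, le_div_iff₀' (zero_lt_iff.2 (w.ne_zero_iff.2 ha0))]
  -- Among the families of lattice vectors, choose one whose determinant has the largest valuation.
  -- It exists because the valuation is discrete and the determinants have a common denominator.
  obtain ⟨z, ⟨x, hx, hxz⟩, hz⟩ := Int.exists_greatest_of_bdd
    (P := fun z => ∃ y : ι → W, (∀ i, y i ∈ L) ∧ w (b.det y) = WithZero.exp z)
    ⟨WithZero.log (w (algebraMap (𝓞 K) K a))⁻¹, by
      rintro z ⟨y, hy, hyz⟩
      have := hbd y hy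
      rw [hyz] at this
      exact (WithZero.le_log_iff_exp_le (by simpa using ha0)).2 this⟩
    ⟨WithZero.log (w (b.det x₀)), x₀, hx₀, (WithZero.exp_log (w.ne_zero_iff.2 hx₀0)).symm⟩
  have hx0 : b.det x ≠ 0 := by
    rw [← w.ne_zero_iff, hxz]; exact WithZero.exp_ne_zero
  have hmax : ∀ y : ι → W, (∀ i, y i ∈ L) → w (b.det y) ≤ w (b.det x) := by
    intro y hy
    by_cases hy0 : w (b.det y) = 0
    · rw [hy0]; exact zero_le
    · rw [hxz, ← WithZero.log_le_iff_le_exp hy0]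
      exact hz _ ⟨y, hy, (WithZero.exp_log hy0).symm⟩
  obtain ⟨hli, hsp⟩ := (Basis.is_basis_iff_det b).2 (isUnit_iff_ne_zero.2 hx0)
  let x' : Basis ι K W := Basis.mk hli hsp.ge
  have hx' : (x' : ι → W) = x := Basis.coe_mk _ _
  refine ⟨x', fun i => by rw [hx']; exact hx i, fun y hy i => ?_, fun d hd => ?_⟩
  -- Cramer's rule: replacing the `i`-th vector by `y` multiplies the determinant by the `i`-th
  -- coordinate of `y`. Maximality therefore makes that coordinate integral.
  · have h1 : b.det (Function.update x i y) = b.det x * x'.repr y i := by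
      have h2 : x'.det (Function.update x i y) = x'.repr y i := by
        rw [Basis.det_apply, Basis.toMatrix_update, ← hx', Basis.toMatrix_self,
          ← Matrix.cramer_apply, Matrix.cramer_one]
        rfl
      rw [← h2, ← hx', Basis.det_apply, Basis.det_apply, Basis.det_apply, ← Matrix.det_mul,
        Basis.toMatrix_mul_toMatrix]
    have h3 := hmax (Function.update x i y) (fun j => by
      by_cases h : j = i
      · subst h; simpa using hy
      · simpa [h] using hx j)
    rw [h1, map_mul] at h3
    exact (mul_le_iff_le_one_right (zero_lt_iff.2 (w.ne_zero_iff.2 hx0))).1 h3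
  · refine valuation_le_of_mem_span w hw ?_ hd
    rintro _ ⟨y, hy, rfl⟩
    rw [hx']; exact hmax y hy

end Lattices

/-! ### Conjugate ideals and determinants with entries in an ideal -/

section Twist

variable {K : Type*} [Field K] [NumberField K]

omit [NumberField K] in
theorem symm_algebraMap (τ : K ≃+* K) (a : 𝓞 K) :
    τ.symm (algebraMap (𝓞 K) K a) =
      algebraMap (𝓞 K) K (RingOfIntegers.mapRingEquiv τ.symm a) := rfl

/-- The image of a fractional ideal under an automorphism of the field. -/
def twist (τ : K ≃+* K) (J : FractionalIdeal (𝓞 K)⁰ K) : FractionalIdeal (𝓞 K)⁰ K :=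
  ⟨{ carrier := {x | τ.symm x ∈ J}
     zero_mem' := by
      change τ.symm 0 ∈ (J : Submodule (𝓞 K) K)
      rw [map_zero]; exact zero_mem _
     add_mem' := fun {x y} hx hy => by
      change τ.symm (x + y) ∈ (J : Submodule (𝓞 K) K)
      rw [map_add]; exact add_mem hx hy
     smul_mem' := fun a x hx => by
      change τ.symm (a • x) ∈ (J : Submodule (𝓞 K) K)
      rw [Algebra.smul_def, map_mul, symm_algebraMap, ← Algebra.smul_def]
      exact Submodule.smul_mem _ _ hx }, by
    obtain ⟨a, ha, h⟩ := J.isFractional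
    refine ⟨RingOfIntegers.mapRingEquiv τ a, ?_, fun x hx => ?_⟩
    · rw [mem_nonZeroDivisors_iff_ne_zero]
      simpa using nonZeroDivisors.ne_zero ha
    · obtain ⟨c, hc⟩ := h _ hx
      refine ⟨RingOfIntegers.mapRingEquiv τ c, ?_⟩
      change τ (algebraMap (𝓞 K) K c) = _
      rw [hc, Algebra.smul_def, Algebra.smul_def, map_mul, RingEquiv.apply_symm_apply]
      rfl⟩

theorem mem_twist {τ : K ≃+* K} {J : FractionalIdeal (𝓞 K)⁰ K} {x : K} :
    x ∈ twist τ J ↔ τ.symm x ∈ J := Iff.rfl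

theorem absNorm_twist (τ : K ≃+* K) (J : FractionalIdeal (𝓞 K)⁰ K) :
    FractionalIdeal.absNorm (twist τ J) = FractionalIdeal.absNorm J :=
  absNorm_eq_of_ringEquiv τ _ _ fun x => by rw [mem_twist, RingEquiv.symm_apply_apply]

theorem prod_mem_pow {ι : Type*} (s : Finset ι) (J : FractionalIdeal (𝓞 K)⁰ K) (f : ι → K)
    (hf : ∀ i ∈ s, f i ∈ J) : ∏ i ∈ s, f i ∈ J ^ s.card := by
  classical
  induction s using Finset.induction_on with
  | empty => simp
  | insert i s hi ih =>
    rw [Finset.prod_insert hi, Finset.card_insert_of_notMem hi, pow_succ']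
    exact FractionalIdeal.mul_mem_mul (hf i (by simp)) (ih fun j hj => hf j (by simp [hj]))

theorem det_mem_pow {ι : Type*} [Fintype ι] [DecidableEq ι] (J : FractionalIdeal (𝓞 K)⁰ K)
    (M : Matrix ι ι K) (hM : ∀ i j, M i j ∈ J) : M.det ∈ J ^ Fintype.card ι := by
  rw [Matrix.det_apply]
  change _ ∈ ((J ^ Fintype.card ι : FractionalIdeal (𝓞 K)⁰ K) : Submodule (𝓞 K) K)
  refine Submodule.sum_mem _ fun σ _ => ?_
  rw [Units.smul_def]
  exact zsmul_mem (show _ ∈ ((J ^ Fintype.card ι : FractionalIdeal (𝓞 K)⁰ K) :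
    Submodule (𝓞 K) K) from prod_mem_pow Finset.univ J _ fun i _ => hM _ _) _

end Twist

/-! ### Discriminants and value ideals of sesquilinear forms -/

section Forms

variable {K : Type*} [Field K] [NumberField K]
  {W : Type*} [AddCommGroup W] [Module K W] [Module (𝓞 K) W] [IsScalarTower (𝓞 K) K W]
  {ι : Type*} [Fintype ι] [DecidableEq ι]

omit [NumberField K] [Module (𝓞 K) W] [IsScalarTower (𝓞 K) K W] in
theorem det_sesq (τ : K ≃+* K) (b : Basis ι K W) (C : Matrix ι ι K) (x y : ι → W) :
    (Matrix.of fun i j => ∑ k, ∑ l, b.repr (x i) k * C k l * τ (b.repr (y j) l)).det =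
      C.det * (b.det x * τ (b.det y)) := by
  have : (Matrix.of fun i j => ∑ k, ∑ l, b.repr (x i) k * C k l * τ (b.repr (y j) l)) =
      (b.toMatrix x).transpose * C * (b.toMatrix y).map τ := by
    ext i j
    simp only [Matrix.of_apply, Matrix.mul_apply, Matrix.transpose_apply, Matrix.map_apply,
      Basis.toMatrix_apply, Finset.sum_mul]
    exact Finset.sum_comm
  rw [this, Matrix.det_mul, Matrix.det_mul, Matrix.det_transpose, Basis.det_apply,
    Basis.det_apply, show (b.toMatrix y).map τ = (τ : K →+* K).mapMatrix (b.toMatrix y) from rfl,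
    ← RingHom.map_det, RingEquiv.coe_toRingHom]
  ring

/-- A sesquilinear form with values on a lattice in the fractional ideal `J` has its discriminant
ideal in a power of `J`. -/
theorem discr_le_pow (τ : K ≃+* K) (L : Submodule (𝓞 K) W) (hL : L.FG) (b : Basis ι K W)
    (C : Matrix ι ι K) (J : FractionalIdeal (𝓞 K)⁰ K)
    (hC : ∀ x ∈ L, ∀ y ∈ L, ∑ k, ∑ l, b.repr x k * C k l * τ (b.repr y l) ∈ J) :
    FractionalIdeal.spanSingleton (𝓞 K)⁰ C.det * (latticeDet L hL b * twist τ (latticeDet L hL b))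
      ≤ J ^ Fintype.card ι := by
  -- By additivity and 𝓞-semilinearity it is enough to treat the generators `b.det x` and `b.det y`.
  -- There the product is the determinant of the matrix of values of the form, whose entries lie in
  -- `J`.
  have key : ∀ d ∈ latticeDet L hL b, ∀ e ∈ latticeDet L hL b,
      C.det * (d * τ e) ∈ J ^ Fintype.card ι := by
    intro d hd e he
    change d ∈ Submodule.span (𝓞 K) _ at hd
    change e ∈ Submodule.span (𝓞 K) _ at he
    change _ ∈ ((J ^ Fintype.card ι : FractionalIdeal (𝓞 K)⁰ K) : Submodule (𝓞 K) K)
    induction hd using Submodule.span_induction with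
    | zero => rw [zero_mul, mul_zero]; exact zero_mem _
    | add d d' _ _ h h' => rw [add_mul, mul_add]; exact add_mem h h'
    | smul a d _ h => rw [smul_mul_assoc, mul_smul_comm]; exact Submodule.smul_mem _ _ h
    | mem d hd =>
      obtain ⟨x, hx, rfl⟩ := hd
      induction he using Submodule.span_induction with
      | zero => rw [map_zero, mul_zero, mul_zero]; exact zero_mem _
      | add d d' _ _ h h' => rw [map_add, mul_add, mul_add]; exact add_mem h h'
      | smul a d _ h =>
        rw [Algebra.smul_def, map_mul, mul_left_comm (b.det x), mul_left_comm C.det]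
        exact Submodule.smul_mem _ (RingOfIntegers.mapRingEquiv τ a) h
      | mem e he =>
        obtain ⟨y, hy, rfl⟩ := he
        rw [← det_sesq]
        exact det_mem_pow J _ fun i j => hC _ (hx i) _ (hy j)
  rw [FractionalIdeal.mul_le]
  intro s hs d hd
  obtain ⟨a, rfl⟩ := FractionalIdeal.mem_spanSingleton _ |>.1 hs
  change _ ∈ ((J ^ Fintype.card ι : FractionalIdeal (𝓞 K)⁰ K) : Submodule (𝓞 K) K)
  rw [smul_mul_assoc]
  refine Submodule.smul_mem _ _ ?_
  refine FractionalIdeal.mul_induction_on hd (fun d hd e he => ?_) (fun d d' h h' => ?_)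
  · have := key d hd (τ.symm e) he
    rwa [RingEquiv.apply_symm_apply] at this
  · rw [mul_add]; exact add_mem h h'

/-- The discriminant ideal of a sesquilinear form on a lattice contains `J` as soon as this holds
locally. -/
theorem le_discr (τ : K ≃+* K) (L : Submodule (𝓞 K) W) (hL : L.FG) (b : Basis ι K W)
    (C : Matrix ι ι K) (J : FractionalIdeal (𝓞 K)⁰ K)
    (hC : ∀ (v : HeightOneSpectrum (𝓞 K)), ∀ d ∈ J, ∃ x y : ι → W, (∀ i, x i ∈ L) ∧
      (∀ i, y i ∈ L) ∧ v.valuation K d ≤ v.valuation K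
        (Matrix.of fun i j => ∑ k, ∑ l, b.repr (x i) k * C k l * τ (b.repr (y j) l)).det) :
    J ≤ FractionalIdeal.spanSingleton (𝓞 K)⁰ C.det *
      (latticeDet L hL b * twist τ (latticeDet L hL b)) := by
  refine fractionalIdeal_le_of_valuation_le fun v d hd => ?_
  obtain ⟨x, y, hx, hy, h⟩ := hC v d hd
  rw [det_sesq] at h
  refine ⟨_, ?_, h⟩
  refine FractionalIdeal.mul_mem_mul (FractionalIdeal.mem_spanSingleton_self _ _)
    (FractionalIdeal.mul_mem_mul (det_mem_latticeDet L hL b x hx) ?_)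
  rw [mem_twist, RingEquiv.symm_apply_apply]
  exact det_mem_latticeDet L hL b y hy

variable {τ : K ≃+* K}

/-- The fractional ideal generated by the values of a sesquilinear form on a lattice. -/
def valueIdeal (L : Submodule (𝓞 K) W) (hL : L.FG) (c : W →ₗ[K] W →ₛₗ[(τ : K →+* K)] K) :
    FractionalIdeal (𝓞 K)⁰ K :=
  ⟨Submodule.span (𝓞 K) {d | ∃ x ∈ L, ∃ y ∈ L, d = c x y}, by
    obtain ⟨S, hS⟩ := hL
    -- The values on pairs of generators of `L` suffice, as `τ` preserves `𝓞 K`. The span is thus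
    -- finitely generated, hence fractional.
    have : Submodule.span (𝓞 K) {d | ∃ x ∈ L, ∃ y ∈ L, d = c x y} =
        Submodule.span (𝓞 K) ((fun p : W × W => c p.1 p.2) '' ((S ×ˢ S : Finset (W × W)) : Set _)) := by
      apply le_antisymm
      · rw [Submodule.span_le]
        rintro _ ⟨x, hx, y, hy, rfl⟩
        rw [← hS] at hx hy
        change c x y ∈ Submodule.span (𝓞 K) _
        induction hx using Submodule.span_induction with
        | zero => simp
        | add d d' _ _ h h' => rw [map_add, LinearMap.add_apply]; exact add_mem h h'
        | smul a d _ h =>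
          rw [← algebraMap_smul K a d, map_smul, LinearMap.smul_apply, algebraMap_smul]
          exact Submodule.smul_mem _ _ h
        | mem x hx =>
          induction hy using Submodule.span_induction with
          | zero => simp
          | add d d' _ _ h h' => rw [map_add]; exact add_mem h h'
          | smul a d _ h =>
            rw [← algebraMap_smul K a d, map_smulₛₗ, smul_eq_mul]
            exact Submodule.smul_mem _ (RingOfIntegers.mapRingEquiv τ a) h
          | mem y hy =>
            exact Submodule.subset_span ⟨(x, y), by simpa using ⟨hx, hy⟩, rfl⟩
      · rw [Submodule.span_le]
        rintro _ ⟨⟨x, y⟩, hxy, rfl⟩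
        simp only [Finset.coe_product, Set.mem_prod, Finset.mem_coe] at hxy
        exact Submodule.subset_span ⟨x, hS ▸ Submodule.subset_span hxy.1, y,
          hS ▸ Submodule.subset_span hxy.2, rfl⟩
    rw [this]
    exact FractionalIdeal.isFractional_of_fg (Submodule.fg_span (Set.Finite.image _ (Finset.finite_toSet _)))⟩

theorem mem_valueIdeal (L : Submodule (𝓞 K) W) (hL : L.FG)
    (c : W →ₗ[K] W →ₛₗ[(τ : K →+* K)] K) {x y : W} (hx : x ∈ L) (hy : y ∈ L) :
    c x y ∈ valueIdeal L hL c :=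
  Submodule.subset_span ⟨x, hx, y, hy, rfl⟩

omit [NumberField K] [Module (𝓞 K) W] [IsScalarTower (𝓞 K) K W] [DecidableEq ι] in
theorem sesq_apply (c : W →ₗ[K] W →ₛₗ[(τ : K →+* K)] K) (b b' : Basis ι K W) (x y : W) :
    c x y = ∑ k, ∑ l, b.repr x k * c (b k) (b' l) * τ (b'.repr y l) := by
  conv_lhs => rw [← b.sum_repr x, ← b'.sum_repr y]
  simp only [map_sum, map_smul, LinearMap.sum_apply, LinearMap.smul_apply, map_smulₛₗ, smul_eq_mul,
    Finset.mul_sum, RingEquiv.coe_toRingHom]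
  rw [Finset.sum_comm]
  refine Finset.sum_congr rfl fun i _ => Finset.sum_congr rfl fun j _ => by ring

end Forms

/-! ### Local norms at the finite places -/

section FiniteNorms

variable {K : Type*} [Field K] [NumberField K] {W : Type*} [AddCommGroup W] [Module K W]

theorem norm_algebraMap_adicCompletion (v : HeightOneSpectrum (𝓞 K)) (a : K) :
    ‖algebraMap K (v.adicCompletion K) a‖ = NumberField.HeightOneSpectrum.adicAbv K v a := by
  rw [← FinitePlace.norm_embedding]
  rfl

theorem norm_algebraMap_lt_iff (v : HeightOneSpectrum (𝓞 K)) (a b : K) :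
    ‖algebraMap K (v.adicCompletion K) a‖ < ‖algebraMap K (v.adicCompletion K) b‖ ↔
      v.valuation K a < v.valuation K b := by
  rw [norm_algebraMap_adicCompletion, norm_algebraMap_adicCompletion,
    NumberField.HeightOneSpectrum.adicAbv_def, NumberField.HeightOneSpectrum.adicAbv_def,
    NNReal.coe_lt_coe,
    (WithZeroMulInt.toNNReal_strictMono
      (NumberField.HeightOneSpectrum.one_lt_absNorm_nnreal v)).lt_iff_lt]

theorem norm_algebraMap_le_iff (v : HeightOneSpectrum (𝓞 K)) (a b : K) :
    ‖algebraMap K (v.adicCompletion K) a‖ ≤ ‖algebraMap K (v.adicCompletion K) b‖ ↔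
      v.valuation K a ≤ v.valuation K b := by
  rw [← not_lt, norm_algebraMap_lt_iff, not_lt]

/-- The scalar `a` is itself admissible in the infimum. With `le_finNorm`, this bounds the norm of
vectors `1 ⊗ w` from both sides by data over `K`, without a description of the lattice over the
completion. -/
theorem finNorm_smul_le (A : AdelicData K W) (v : HeightOneSpectrum (𝓞 K)) (a : K) {w : W}
    (hw : w ∈ A.lattice) :
    A.finNorm v (1 ⊗ₜ (a • w)) ≤ ‖algebraMap K (v.adicCompletion K) a‖ := by
  refine csInf_le ⟨0, ?_⟩ ⟨algebraMap K (v.adicCompletion K) a, rfl, 1 ⊗ₜ w,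
    Submodule.subset_span ⟨w, hw, rfl⟩, ?_⟩
  · rintro _ ⟨α, rfl, -⟩; exact norm_nonneg _
  · rw [TensorProduct.tmul_smul, algebraMap_smul]

/-- The extension of `f` to `K_v` sends `L_v` into the integers, so every admissible `α` satisfies
`|f w| ≤ |α|`. The hypothesis `hw` supplies one admissible scalar: without any, the infimum would
take the default value `0`. -/
theorem le_finNorm (A : AdelicData K W) (v : HeightOneSpectrum (𝓞 K)) (f : W →ₗ[K] K)
    (hf : ∀ w ∈ A.lattice, v.valuation K (f w) ≤ 1) {w : W}
    (hw : ∃ d : K, d ≠ 0 ∧ d • w ∈ A.lattice) :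
    ‖algebraMap K (v.adicCompletion K) (f w)‖ ≤ A.finNorm v (1 ⊗ₜ w) := by
  obtain ⟨d, hd, hdw⟩ := hw
  refine le_csInf ⟨_, algebraMap K (v.adicCompletion K) d⁻¹, rfl, 1 ⊗ₜ (d • w),
    Submodule.subset_span ⟨_, hdw, rfl⟩, ?_⟩ ?_
  · rw [algebraMap_smul, ← TensorProduct.tmul_smul, smul_smul, inv_mul_cancel₀ hd, one_smul]
  · rintro _ ⟨α, rfl, y, hy, hxy⟩
    let g : v.adicCompletion K ⊗[K] W →ₗ[v.adicCompletion K] v.adicCompletion K :=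
      LinearMap.liftBaseChange (v.adicCompletion K)
        ((Algebra.linearMap K (v.adicCompletion K)).comp f)
    have hg : ∀ u : W, g (1 ⊗ₜ u) = algebraMap K (v.adicCompletion K) (f u) := fun u => by
      simp [g]
    have hgy : g y ∈ v.adicCompletionIntegers K := by
      clear hxy
      induction hy using Submodule.span_induction with
      | mem y hy =>
        obtain ⟨u, hu, rfl⟩ := hy
        beta_reduce
        rw [hg, HeightOneSpectrum.mem_adicCompletionIntegers]
        exact (HeightOneSpectrum.valuedAdicCompletion_eq_valuation' v (f u)).trans_le (hf u hu)
      | zero => rw [map_zero]; exact zero_mem _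
      | add y z _ _ hy hz => rw [map_add]; exact add_mem hy hz
      | smul a y _ hy =>
        have : g (a • y) = (a : v.adicCompletion K) * g y := g.map_smul (a : v.adicCompletion K) y
        rw [this]; exact mul_mem a.2 hy
    have hn : ‖g y‖ ≤ 1 := Valued.toNormedField.norm_le_one_iff.2 hgy
    rw [← hg, hxy, map_smul, smul_eq_mul, norm_mul]
    exact mul_le_of_le_one_right (norm_nonneg _) hn

end FiniteNorms

/-! ### Singular matrices modulo a maximal ideal -/

section LocalAlgebra

open scoped WithZero

/-- A matrix over a valuation ring whose determinant is not a unit has a primitive vector in its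
left kernel modulo the maximal ideal. -/
theorem exists_primitive_of_det_lt_one {K Γ : Type*} [Field K]
    [LinearOrderedCommGroupWithZero Γ] (w : Valuation K Γ) {ι : Type*} [Fintype ι] [DecidableEq ι]
    (M : Matrix ι ι K) (hM : ∀ i j, w (M i j) ≤ 1) (hdet : w M.det < 1) :
    ∃ r : ι → K, (∀ i, w (r i) ≤ 1) ∧ (∃ i, w (r i) = 1) ∧ ∀ j, w (∑ i, r i * M i j) < 1 := by
  let R := w.valuationSubring
  let N : Matrix ι ι R := fun i j => ⟨M i j, hM i j⟩
  have hN : M = R.subtype.mapMatrix N := rfl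
  have hres : ∀ a : R, IsLocalRing.residue R a = 0 ↔ w a < 1 := fun a => by
    rw [IsLocalRing.residue_eq_zero_iff]
    exact Valuation.mem_maximalIdeal_iff ..
  -- The reduced matrix is singular over the residue field. Lifting a nonzero kernel vector gives
  -- `r`, and a coordinate with nonzero residue is a unit.
  have h0 : ((IsLocalRing.residue R).mapMatrix N).det = 0 := by
    rw [← RingHom.map_det, hres]
    rw [hN, ← RingHom.map_det] at hdet
    exact hdet
  obtain ⟨u, hu0, hu⟩ := Matrix.exists_vecMul_eq_zero_iff.2 h0
  choose r hr using fun i => IsLocalRing.residue_surjective (u i)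
  obtain ⟨i, hi⟩ := Function.ne_iff.1 hu0
  refine ⟨fun i => r i, fun i => (r i).2, ⟨i, le_antisymm (r i).2 ?_⟩, fun j => ?_⟩
  · rw [← not_lt, ← hres, hr]; exact hi
  · have h1 : IsLocalRing.residue R (∑ i, r i * N i j) = 0 := by
      have := congrFun hu j
      simp only [map_sum, map_mul, hr]
      exact this
    rw [hres] at h1
    simpa [N] using h1

end LocalAlgebra

/-! ### Local unimodularity at the finite places -/

section LocalDuality

open scoped WithZero

variable {K : Type*} [Field K] [NumberField K]
  {E : Type*} [AddCommGroup E] [Module K E] [Module (𝓞 K) E] [IsScalarTower (𝓞 K) K E]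
  {ι : Type*} [Fintype ι] [DecidableEq ι] {τ : K ≃+* K}

/-- A functional integral at `v` becomes integral everywhere after multiplication by an element
prime to `v`, one for all generators of `L`. This places it in the global dual lattice without
changing its size at `v`. -/
theorem exists_primeCompl_mul_mem (v : HeightOneSpectrum (𝓞 K)) (L : Submodule (𝓞 K) E)
    (hL : L.FG) (f : E →ₛₗ[(τ : K →+* K)] K) (hf : ∀ y ∈ L, v.valuation K (f y) ≤ 1) :
    ∃ s ∈ v.asIdeal.primeCompl, ∀ y ∈ L, algebraMap (𝓞 K) K s * f y ∈ (algebraMap (𝓞 K) K).range := by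
  induction L, hL using Submodule.fg_induction with
  | singleton x =>
    obtain ⟨r, s, hrs⟩ := v.exists_primeCompl_mul_eq_of_integer (f x)
      (hf x (Submodule.mem_span_singleton_self x))
    refine ⟨s, s.2, fun y hy => ?_⟩
    obtain ⟨a, rfl⟩ := Submodule.mem_span_singleton.1 hy
    refine ⟨RingOfIntegers.mapRingEquiv τ a * r, ?_⟩
    rw [← algebraMap_smul K a x, map_smulₛₗ, smul_eq_mul, mul_left_comm, mul_comm _ (f x), hrs,
      map_mul]
    rfl
  | sup L₁ L₂ _ _ h₁ h₂ =>
    obtain ⟨s, hs, h₁⟩ := h₁ fun y hy => hf y (Submodule.mem_sup_left hy)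
    obtain ⟨t, ht, h₂⟩ := h₂ fun y hy => hf y (Submodule.mem_sup_right hy)
    refine ⟨s * t, mul_mem hs ht, fun y hy => ?_⟩
    obtain ⟨y₁, hy₁, y₂, hy₂, rfl⟩ := Submodule.mem_sup.1 hy
    rw [map_add, map_mul, mul_add]
    refine add_mem ?_ ?_
    · rw [mul_assoc, mul_left_comm]; exact mul_mem ⟨t, rfl⟩ (h₁ _ hy₁)
    · rw [mul_assoc]; exact mul_mem ⟨s, rfl⟩ (h₂ _ hy₂)

/-- If `E → D` multiplies the local norm at a finite place by a constant, `D` being a dual or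
conjugate dual of `E`, then locally the discriminant generates a power of the ideal of values. -/
theorem exists_valuation_le_det (L : Submodule (𝓞 K) E) (hL : L.FG)
    (hs : Submodule.span K (L : Set E) = ⊤) (b : Basis ι K E) [Nonempty ι]
    {D : Type*} [AddCommGroup D] [Module K D] (AE : AdelicData K E) (AD : AdelicData K D)
    (hAE : AE.lattice = L.toAddSubgroup)
    (p : D →ₗ[K] E →ₛₗ[(τ : K →+* K)] K)
    (hAD : ∀ φ, φ ∈ AD.lattice ↔ ∀ x ∈ L, p φ x ∈ (algebraMap (𝓞 K) K).range)
    (σ : E →ₗ[K] D) (hinj : ∀ x, p (σ x) = 0 → x = 0)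
    (v : HeightOneSpectrum (𝓞 K)) (lam : ℝ) (hlam : 0 < lam)
    (hσ : ∀ x, AD.finNorm v (1 ⊗ₜ σ x) = lam * AE.finNorm v (1 ⊗ₜ x)) :
    ∀ d ∈ valueIdeal L hL (p.comp σ) ^ Fintype.card ι, ∃ x y : ι → E, (∀ i, x i ∈ L) ∧
      (∀ i, y i ∈ L) ∧
      v.valuation K d ≤ v.valuation K (Matrix.of fun i j => p (σ (x i)) (y j)).det := by
  set w := v.valuation K with hw
  have hw1 : ∀ a : 𝓞 K, w a ≤ 1 := v.valuation_le_one
  obtain ⟨x, hxL, hxr, -⟩ := exists_local_basis L hL hs b w hw1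
  -- The second variable is `τ`-semilinear, so its local basis is taken for the valuation composed
  -- with `τ`.
  obtain ⟨y, hyL, hyr, -⟩ := exists_local_basis L hL hs b (w.comap (τ : K →+* K))
    (fun a => hw1 (RingOfIntegers.mapRingEquiv τ a))
  have hyr' : ∀ z ∈ L, ∀ i, w (τ (y.repr z i)) ≤ 1 := hyr
  set c : E →ₗ[K] E →ₛₗ[(τ : K →+* K)] K := p.comp σ with hc
  have hc' : ∀ x y, c x y = p (σ x) y := fun _ _ => rfl
  -- The largest value `a` on the two local bases is the largest on `L` by sesquilinearity: locally
  -- `a` generates the ideal of values.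
  obtain ⟨⟨i₀, j₀⟩, hmax⟩ := Finite.exists_max fun q : ι × ι => w (c (x q.1) (y q.2))
  set a := c (x i₀) (y j₀) with ha
  have hcle : ∀ u ∈ L, ∀ z ∈ L, w (c u z) ≤ w a := by
    intro u hu z hz
    rw [sesq_apply c x y]
    refine w.map_sum_le fun i _ => w.map_sum_le fun j _ => ?_
    rw [map_mul, map_mul]
    calc _ ≤ 1 * w (c (x i) (y j)) * 1 := by
          gcongr
          · exact hxr u hu i
          · exact hyr' z hz j
      _ ≤ w a := by rw [one_mul, mul_one]; exact hmax (i, j)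
  have ha0 : a ≠ 0 := by
    intro h0
    refine x.ne_zero i₀ (hinj _ (LinearMap.ext fun z => ?_))
    change c (x i₀) z = 0
    rw [sesq_apply c x y]
    refine Finset.sum_eq_zero fun i _ => Finset.sum_eq_zero fun j _ => ?_
    have : w (c (x i) (y j)) ≤ w a := hmax (i, j)
    rw [h0, map_zero, le_zero_iff, w.zero_iff] at this
    rw [this, mul_zero, zero_mul]
  have hwa : 0 < w a := zero_lt_iff.2 (w.ne_zero_iff.2 ha0)
  -- elements with bounded values have bounded image
  have hbound : ∀ u : E, ∀ e : K, e ≠ 0 → (∀ z ∈ L, w (c u z) ≤ w e) →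
      AD.finNorm v (1 ⊗ₜ σ u) ≤ ‖algebraMap K (v.adicCompletion K) e‖ ∧
        ∃ d : K, d ≠ 0 ∧ d • σ u ∈ AD.lattice := by
    intro u e he hu
    obtain ⟨s, hs, hsL⟩ := exists_primeCompl_mul_mem v L hL (e⁻¹ • c u) (fun z hz => by
      rw [LinearMap.smul_apply, smul_eq_mul, map_mul, map_inv₀,
        inv_mul_le_iff₀ (zero_lt_iff.2 (w.ne_zero_iff.2 he)), mul_one]
      exact hu z hz)
    have hws : w (algebraMap (𝓞 K) K s) = 1 := v.valuation_eq_one_iff_notMem.2 hs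
    have hs0 : algebraMap (𝓞 K) K s ≠ 0 := fun h => by simp [h] at hws
    have hmem : (algebraMap (𝓞 K) K s * e⁻¹) • σ u ∈ AD.lattice := by
      rw [hAD]
      intro z hz
      have := hsL z hz
      rw [map_smul, LinearMap.smul_apply, smul_eq_mul, mul_assoc]
      exact this
    refine ⟨?_, _, mul_ne_zero hs0 (inv_ne_zero he), hmem⟩
    have h1 := finNorm_smul_le AD v (e * (algebraMap (𝓞 K) K s)⁻¹) hmem
    rw [smul_smul, show e * (algebraMap (𝓞 K) K s)⁻¹ * (algebraMap (𝓞 K) K s * e⁻¹) = 1 by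
      field_simp, one_smul] at h1
    refine h1.trans ((norm_algebraMap_le_iff v _ _).2 ?_)
    rw [← hw, map_mul, map_inv₀, hws, inv_one, mul_one]
  -- the ratio is at least `|a|`
  have hlow : ‖algebraMap K (v.adicCompletion K) a‖ ≤ lam := by
    have h1 : ‖algebraMap K (v.adicCompletion K) a‖ ≤ AD.finNorm v (1 ⊗ₜ σ (x i₀)) := by
      let f : D →ₗ[K] K :=
        { toFun := fun φ => p φ (y j₀)
          map_add' := fun φ ψ => by rw [map_add, LinearMap.add_apply]
          map_smul' := fun r φ => by rw [map_smul, LinearMap.smul_apply]; rfl }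
      refine le_finNorm AD v f (fun φ hφ => ?_) (hbound _ a ha0 fun z hz => hcle _ (hxL i₀) z hz).2
      obtain ⟨r, hr⟩ := (hAD φ).1 hφ _ (hyL j₀)
      change w (p φ (y j₀)) ≤ 1
      rw [← hr]; exact hw1 r
    have h2 : AE.finNorm v (1 ⊗ₜ x i₀) ≤ 1 := by
      have := finNorm_smul_le AE v 1 (w := x i₀) (by rw [hAE]; exact hxL i₀)
      simpa using this
    rw [hσ] at h1
    exact h1.trans (mul_le_of_le_one_right hlam.le h2)
  have hM : ∀ i j, w (a⁻¹ * c (x i) (y j)) ≤ 1 := fun i j => by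
    rw [map_mul, map_inv₀, inv_mul_le_iff₀ hwa, mul_one]
    exact hmax (i, j)
  -- If `c / a` were singular modulo `v`, a vector `u` with integral coordinates, one of them a
  -- unit, would have all `c u z` divisible by `π a`. Then `‖σ u‖ ≤ |π a| < |a| ≤ lam`, whereas `‖u‖
  -- ≥ 1` forces `‖σ u‖ ≥ lam`.
  have hdet : ¬ w (Matrix.of fun i j => a⁻¹ * c (x i) (y j)).det < 1 := by
    intro hlt
    obtain ⟨r, hr, ⟨i₁, hi₁⟩, hrM⟩ := exists_primitive_of_det_lt_one w _ hM hlt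
    obtain ⟨π, hπ⟩ := v.valuation_exists_uniformizer K
    have hπ0 : π ≠ 0 := fun h => by
      rw [h, map_zero] at hπ; exact WithZero.exp_ne_zero hπ.symm
    set u := ∑ i, r i • x i with hu
    have hur : x.repr u i₁ = r i₁ := by rw [hu, Basis.repr_sum_self]
    have huy : ∀ j, w (c u (y j)) ≤ w (π * a) := fun j => by
      have h1 := hrM j
      have h2 : ∑ i, r i * (a⁻¹ * c (x i) (y j)) = a⁻¹ * c u (y j) := by
        rw [hu, map_sum, LinearMap.sum_apply, Finset.mul_sum]
        refine Finset.sum_congr rfl fun i _ => ?_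
        rw [map_smul, LinearMap.smul_apply, smul_eq_mul]; ring
      rw [h2] at h1
      -- The valuation is discrete: a value below `1` is at most that of the uniformizer.
      have h3 : w (a⁻¹ * c u (y j)) ≤ w π := by
        rw [hπ]
        by_cases h0 : w (a⁻¹ * c u (y j)) = 0
        · rw [h0]; exact zero_le
        · rw [← WithZero.log_le_iff_le_exp h0]
          rw [← WithZero.exp_zero, ← WithZero.log_lt_iff_lt_exp h0] at h1
          omega
      rw [map_mul, map_inv₀, inv_mul_le_iff₀ hwa] at h3
      rw [map_mul, mul_comm]; exact h3
    have huz : ∀ z ∈ L, w (c u z) ≤ w (π * a) := fun z hz => by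
      rw [← y.sum_repr z, map_sum]
      refine w.map_sum_le fun j _ => ?_
      rw [map_smulₛₗ, smul_eq_mul, map_mul]
      exact (mul_le_of_le_one_left' (hyr' z hz j)).trans (huy j)
    have h1 := (hbound u (π * a) (mul_ne_zero hπ0 ha0) huz).1
    have h2 : ‖algebraMap K (v.adicCompletion K) (x.coord i₁ u)‖ ≤ AE.finNorm v (1 ⊗ₜ u) := by
      refine le_finNorm AE v (x.coord i₁) (fun z hz => ?_) ?_
      · rw [hAE] at hz; exact hxr z hz i₁
      · obtain ⟨d, hd, hdu⟩ := RigidAdelicSpace.clear_denom L hs u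
        refine ⟨algebraMap (𝓞 K) K d, by simpa using hd, ?_⟩
        rw [hAE, algebraMap_smul]; exact hdu
    have h3 : (1 : ℝ) ≤ AE.finNorm v (1 ⊗ₜ u) := by
      refine le_trans ?_ h2
      have := (norm_algebraMap_le_iff v 1 (x.coord i₁ u)).2
        (by rw [← hw, map_one, Basis.coord_apply, hur, hi₁])
      simpa using this
    have h4 : ‖algebraMap K (v.adicCompletion K) (π * a)‖ <
        ‖algebraMap K (v.adicCompletion K) a‖ := by
      rw [norm_algebraMap_lt_iff, ← hw, map_mul]
      refine mul_lt_of_lt_one_left hwa ?_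
      rw [hπ, ← WithZero.exp_zero, WithZero.exp_lt_exp]; norm_num
    rw [hσ] at h1
    have h5 : lam ≤ lam * AE.finNorm v (1 ⊗ₜ u) := le_mul_of_one_le_right hlam.le h3
    linarith
  intro d hd
  refine ⟨x, y, hxL, hyL, ?_⟩
  have hdet' : (Matrix.of fun i j => p (σ (x i)) (y j)).det =
      a ^ Fintype.card ι * (Matrix.of fun i j => a⁻¹ * c (x i) (y j)).det := by
    rw [← Matrix.det_smul]
    congr 1
    ext i j
    simp only [Matrix.of_apply, Matrix.smul_apply, smul_eq_mul, hc']
    field_simp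
  -- Elements of the `k`-th power of the value ideal are bounded by `a ^ k`; the discriminant is `a
  -- ^ n` times a factor of valuation at least `1`.
  have hwd : ∀ k : ℕ, ∀ d ∈ valueIdeal L hL c ^ k, w d ≤ w a ^ k := by
    intro k
    induction k with
    | zero =>
      intro d hd
      rw [pow_zero, FractionalIdeal.mem_one_iff] at hd
      obtain ⟨r, rfl⟩ := hd
      rw [pow_zero]; exact hw1 r
    | succ k ih =>
      intro d hd
      rw [pow_succ] at hd
      refine FractionalIdeal.mul_induction_on hd (fun d hd e he => ?_) fun d e hd he =>
        w.map_add_le hd he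
      rw [map_mul, pow_succ]
      refine mul_le_mul' (ih d hd) (valuation_le_of_mem_span w hw1 ?_ he)
      rintro _ ⟨u, hu, z, hz, rfl⟩
      exact hcle u hu z hz
  rw [hdet', map_mul, map_pow]
  exact (hwd _ d hd).trans (le_mul_of_one_le_right' (not_lt.1 hdet))

end LocalDuality

/-! ### Determinant ideals in an exact sequence -/

section Quotient

open scoped WithZero

theorem valuation_det_le_one {K Γ : Type*} [Field K]
    [LinearOrderedCommGroupWithZero Γ] (w : Valuation K Γ) {ι : Type*} [Fintype ι] [DecidableEq ι]
    (M : Matrix ι ι K) (hM : ∀ i j, w (M i j) ≤ 1) : w M.det ≤ 1 := by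
  rw [Matrix.det_apply]
  refine w.map_sum_le fun s _ => ?_
  rcases Int.units_eq_one_or (Equiv.Perm.sign s) with h | h <;> rw [h] <;>
    simp only [one_smul, Units.neg_smul, Valuation.map_neg, map_prod] <;>
    exact Finset.prod_le_one' fun i _ => hM _ _

variable {K : Type*} [Field K] [NumberField K]
  {ι κ : Type*} [Fintype ι] [DecidableEq ι] [Fintype κ] [DecidableEq κ]

omit [DecidableEq κ] in
theorem exists_primeCompl_family (v : HeightOneSpectrum (𝓞 K)) (r : κ → K)
    (hr : ∀ k, v.valuation K (r k) ≤ 1) : ∃ s ∈ v.asIdeal.primeCompl,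
      ∀ k, ∃ a : 𝓞 K, algebraMap (𝓞 K) K a = algebraMap (𝓞 K) K s * r k := by
  choose n s hns using fun k => v.exists_primeCompl_mul_eq_of_integer (r k) (hr k)
  refine ⟨∏ k, (s k : 𝓞 K), prod_mem fun k _ => (s k).2, fun k => ?_⟩
  obtain ⟨q, hq⟩ := Finset.dvd_prod_of_mem (fun k => (s k : 𝓞 K)) (Finset.mem_univ k)
  refine ⟨n k * q, ?_⟩
  rw [hq, map_mul, map_mul, ← hns]; ring

variable {U W : Type*} [AddCommGroup U] [Module K U] [Module (𝓞 K) U] [IsScalarTower (𝓞 K) K U]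
  [AddCommGroup W] [Module K W] [Module (𝓞 K) W] [IsScalarTower (𝓞 K) K W]

/-- The coordinates modulo the span of the first part of a basis. -/
def coordInr (b : Basis (ι ⊕ κ) K U) : U →ₗ[K] (κ → K) :=
  LinearMap.pi fun k => b.coord (Sum.inr k)

omit [NumberField K] [Module (𝓞 K) U] [IsScalarTower (𝓞 K) K U] [Fintype ι] [DecidableEq ι]
  [Fintype κ] [DecidableEq κ] in
theorem coordInr_apply (b : Basis (ι ⊕ κ) K U) (u : U) (k : κ) :
    coordInr b u k = b.repr u (Sum.inr k) := rfl

/-- The determinant ideal of a lattice is contained in the product of those of its trace on a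
subspace and of its image in the quotient. -/
theorem latticeDet_le_mul (L : Submodule (𝓞 K) U) (hL : L.FG)
    (hs : Submodule.span K (L : Set U) = ⊤) (b : Basis (ι ⊕ κ) K U)
    (M : Submodule (𝓞 K) W) (hM : M.FG) (hMs : Submodule.span K (M : Set W) = ⊤)
    (bW : Basis ι K W) (j : W →ₗ[K] U) (hj : ∀ i, j (bW i) = b (Sum.inl i))
    (hjM : ∀ z, j z ∈ L → z ∈ M) :
    latticeDet L hL b ≤
      latticeDet (L.map ((coordInr b).restrictScalars (𝓞 K))) (hL.map _) (Pi.basisFun K κ) *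
        latticeDet M hM bW := by
  refine fractionalIdeal_le_of_valuation_le fun v => ?_
  set w := v.valuation K with hw
  have hw1 : ∀ a : 𝓞 K, w a ≤ 1 := v.valuation_le_one
  have hs' : Submodule.span K (L.map ((coordInr b).restrictScalars (𝓞 K)) : Set (κ → K)) = ⊤ := by
    have : (L.map ((coordInr b).restrictScalars (𝓞 K)) : Set (κ → K)) = coordInr b '' L := rfl
    rw [this, ← Submodule.map_span, hs, Submodule.map_top, LinearMap.range_eq_top]
    intro f
    refine ⟨∑ k, f k • b (Sum.inr k), ?_⟩
    ext l
    rw [coordInr_apply]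
    simp [Finsupp.single_apply]
  obtain ⟨z, hzM, hzr, -⟩ := exists_local_basis M hM hMs bW w hw1
  obtain ⟨y', hyL', hyr, -⟩ := exists_local_basis _ (hL.map ((coordInr b).restrictScalars (𝓞 K)))
    hs' (Pi.basisFun K κ) w hw1
  choose y hyL hy using hyL'
  have hy' : ∀ k, coordInr b (y k) = y' k := hy
  have hjb : ∀ t : W, ∀ i, b.repr (j t) (Sum.inl i) = bW.repr t i := fun t i => by
    conv_lhs => rw [← bW.sum_repr t, map_sum]
    simp only [map_smul, hj]
    simp [Finsupp.single_apply]
  have hjb' : ∀ t : W, ∀ k, b.repr (j t) (Sum.inr k) = 0 := fun t k => by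
    conv_lhs => rw [← bW.sum_repr t, map_sum]
    simp only [map_smul, hj]
    simp
  -- A local basis of `M` followed by lifts to `L` of a local basis of the image. Its matrix is
  -- block triangular, and `hcoef` shows that it generates `L` locally.
  set B : ι ⊕ κ → U := Sum.elim (fun i => j (z i)) y with hB
  have hdetB : b.det B = (Pi.basisFun K κ).det y' * bW.det z := by
    have : b.toMatrix B = Matrix.fromBlocks (bW.toMatrix z)
        (Matrix.of fun i k => b.repr (y k) (Sum.inl i)) 0 ((Pi.basisFun K κ).toMatrix y') := by
      ext (i | k) (i' | k')
      · simp [Basis.toMatrix_apply, hB, hjb]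
      · simp [Basis.toMatrix_apply, hB]
      · simp [Basis.toMatrix_apply, hB, hjb']
      · simp [Basis.toMatrix_apply, hB, ← hy', coordInr_apply]
    rw [Basis.det_apply, this, Matrix.det_fromBlocks_zero₂₁, mul_comm]; rfl
  have hcoef : ∀ u ∈ L, ∃ t : ι ⊕ κ → K, (∀ s, w (t s) ≤ 1) ∧ u = ∑ s, t s • B s := by
    intro u hu
    set r : κ → K := fun k => y'.repr (coordInr b u) k with hr
    have hr1 : ∀ k, w (r k) ≤ 1 := hyr _ ⟨u, hu, rfl⟩
    -- The coefficients `r` are integral at `v` only, so `u₀` need not lie in `L`. The factor `s`, a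
    -- unit at `v`, brings it back there, so that `hjM` applies.
    obtain ⟨s, hsp, hsr⟩ := exists_primeCompl_family v r hr1
    choose a ha using hsr
    have hws : w (algebraMap (𝓞 K) K s) = 1 := v.valuation_eq_one_iff_notMem.2 hsp
    set u₀ := u - ∑ k, r k • y k with hu₀
    have hu₀π : coordInr b u₀ = 0 := by
      rw [hu₀, map_sub, map_sum]
      simp only [map_smul, hy', hr]
      rw [y'.sum_repr, sub_self]
    set t : W := ∑ i, b.repr u₀ (Sum.inl i) • bW i with ht
    have hjt : j t = u₀ := by
      rw [ht, map_sum]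
      conv_rhs => rw [← b.sum_repr u₀, Fintype.sum_sum_type]
      have : ∀ k, b.repr u₀ (Sum.inr k) = 0 := fun k => congrFun hu₀π k
      simp [this, hj]
    have hst : s • t ∈ M := by
      apply hjM
      rw [← algebraMap_smul K s t, map_smul, hjt, hu₀, smul_sub, Finset.smul_sum, algebraMap_smul]
      refine sub_mem (L.smul_mem _ hu) (sum_mem fun k _ => ?_)
      rw [smul_smul, ← ha, algebraMap_smul]
      exact L.smul_mem _ (hyL k)
    have htr : ∀ i, w (z.repr t i) ≤ 1 := fun i => by
      have := hzr _ hst i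
      rwa [← algebraMap_smul K s t, map_smul, Finsupp.smul_apply, smul_eq_mul, map_mul, hws,
        one_mul] at this
    refine ⟨Sum.elim (fun i => z.repr t i) r, ?_, ?_⟩
    · rintro (i | k)
      · exact htr i
      · exact hr1 k
    · rw [Fintype.sum_sum_type]
      simp only [hB, Sum.elim_inl, Sum.elim_inr, ← map_smul, ← map_sum]
      rw [z.sum_repr, hjt, hu₀, sub_add_cancel]
  intro d hd
  refine ⟨b.det B, ?_, ?_⟩
  · rw [hdetB]
    exact FractionalIdeal.mul_mem_mul (det_mem_latticeDet _ _ _ _ fun k => ⟨y k, hyL k, hy k⟩)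
      (det_mem_latticeDet _ _ _ _ hzM)
  · refine valuation_le_of_mem_span w hw1 ?_ hd
    rintro _ ⟨x, hx, rfl⟩
    choose t ht htx using fun s => hcoef (x s) (hx s)
    have : b.toMatrix x = b.toMatrix B * Matrix.of fun s s' => t s' s := by
      ext s s'
      rw [Matrix.mul_apply, Basis.toMatrix_apply, htx s']
      simp [Basis.toMatrix_apply, mul_comm]
    rw [Basis.det_apply, this, Matrix.det_mul, map_mul, ← Basis.det_apply]
    exact mul_le_of_le_one_right' (valuation_det_le_one w _ fun s s' => ht s' s)

end Quotient

/-! ### Determinant estimates for Hermitian metrics -/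

section Matrices

open scoped ComplexOrder Matrix

variable {κ ι : Type*} [Fintype κ] [Fintype ι]

/-- The sesquilinear form of a matrix. -/
def herm (Q : Matrix κ κ ℂ) (x y : κ → ℂ) : ℂ := star x ⬝ᵥ Q *ᵥ y

theorem herm_smul_left (Q : Matrix κ κ ℂ) (a : ℂ) (x y : κ → ℂ) :
    herm Q (a • x) y = star a * herm Q x y := by
  rw [herm, star_smul, smul_dotProduct, smul_eq_mul]; rfl

theorem herm_smul_right (Q : Matrix κ κ ℂ) (a : ℂ) (x y : κ → ℂ) :
    herm Q x (a • y) = a * herm Q x y := by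
  rw [herm, Matrix.mulVec_smul, dotProduct_smul, smul_eq_mul]; rfl

theorem herm_sub_left (Q : Matrix κ κ ℂ) (x x' y : κ → ℂ) :
    herm Q (x - x') y = herm Q x y - herm Q x' y := by
  simp only [herm, star_sub, sub_dotProduct]

theorem herm_sub_right (Q : Matrix κ κ ℂ) (x y y' : κ → ℂ) :
    herm Q x (y - y') = herm Q x y - herm Q x y' := by
  simp only [herm, Matrix.mulVec_sub, dotProduct_sub]

theorem herm_add_left (Q : Matrix κ κ ℂ) (x x' y : κ → ℂ) :
    herm Q (x + x') y = herm Q x y + herm Q x' y := by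
  simp only [herm, star_add, add_dotProduct]

theorem herm_add_right (Q : Matrix κ κ ℂ) (x y y' : κ → ℂ) :
    herm Q x (y + y') = herm Q x y + herm Q x y' := by
  simp only [herm, Matrix.mulVec_add, dotProduct_add]

theorem herm_zero_right (Q : Matrix κ κ ℂ) (x : κ → ℂ) : herm Q x 0 = 0 := by
  simp [herm]

theorem star_herm (Q : Matrix κ κ ℂ) (x y : κ → ℂ) : star (herm Q x y) = herm Qᴴ y x := by
  rw [herm, herm, Matrix.star_dotProduct, Matrix.star_mulVec, star_star, ← Matrix.dotProduct_mulVec,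
    dotProduct_comm]

theorem herm_mulVec_left (A B : Matrix κ κ ℂ) (x y : κ → ℂ) :
    herm B (A *ᵥ x) y = herm (Aᴴ * B) x y := by
  rw [herm, herm, Matrix.star_mulVec, ← Matrix.dotProduct_mulVec, Matrix.mulVec_mulVec]

theorem herm_mulVec_right (A B : Matrix κ κ ℂ) (x y : κ → ℂ) :
    herm B x (A *ᵥ y) = herm (B * A) x y := by
  rw [herm, herm, Matrix.mulVec_mulVec]

theorem herm_pos {Q : Matrix κ κ ℂ} (hQ : Q.PosDef) {x : κ → ℂ} (hx : x ≠ 0) :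
    0 < (herm Q x x).re := (Complex.lt_def.1 (hQ.dotProduct_mulVec_pos hx)).1

theorem herm_nonneg {Q : Matrix κ κ ℂ} (hQ : Q.PosDef) (x : κ → ℂ) :
    0 ≤ (herm Q x x).re :=
  (Complex.le_def.1 (hQ.posSemidef.dotProduct_mulVec_nonneg x)).1

theorem herm_self {Q : Matrix κ κ ℂ} (hQ : Q.IsHermitian) (x : κ → ℂ) :
    ((herm Q x x).re : ℂ) = herm Q x x := by
  rw [← Complex.conj_eq_iff_re]
  exact (star_herm Q x x).trans (by rw [hQ.eq])

/-- The Cauchy-Schwarz inequality. -/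
theorem norm_herm_sq_le {Q : Matrix κ κ ℂ} (hQ : Q.PosDef) (x y : κ → ℂ) :
    ‖herm Q x y‖ ^ 2 ≤ (herm Q x x).re * (herm Q y y).re := by
  by_cases hy : y = 0
  · subst hy; simp [herm_zero_right]
  set q := (herm Q y y).re with hq
  have hq0 : 0 < q := herm_pos hQ hy
  have hqq : herm Q y y = q := (herm_self hQ.1 y).symm
  set X := (herm Q x x).re with hX
  have hXX : herm Q x x = X := (herm_self hQ.1 x).symm
  have hs : star (herm Q x y) = herm Q y x := by rw [star_herm, hQ.1.eq]
  -- This vector is `q` times the component of `x` orthogonal to `y`; the factor `q` avoids a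
  -- division.
  have h := herm_nonneg hQ ((q : ℂ) • x - herm Q y x • y)
  have h2 : herm Q ((q : ℂ) • x - herm Q y x • y) ((q : ℂ) • x - herm Q y x • y) =
      ((q * (q * X - ‖herm Q x y‖ ^ 2) : ℝ) : ℂ) := by
    have h3 : star (herm Q y x) = herm Q x y := by rw [← hs, star_star]
    have h4 : herm Q x y * herm Q y x = ((‖herm Q x y‖ ^ 2 : ℝ) : ℂ) := by
      rw [← hs]; simpa using Complex.mul_conj' (herm Q x y)
    simp only [herm_sub_left, herm_sub_right, herm_smul_left, herm_smul_right, hqq, hXX, h3]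
    push_cast at h4 ⊢
    simp only [RCLike.star_def, Complex.conj_ofReal]
    linear_combination (-(q : ℂ)) * h4
  rw [h2, Complex.ofReal_re] at h
  have := (mul_nonneg_iff_of_pos_left hq0).1 h
  linarith

variable [DecidableEq κ] [DecidableEq ι]

theorem norm_multiset_prod_le (s : Multiset ℂ) (c : ℝ) (h : ∀ z ∈ s, ‖z‖ ≤ c) :
    ‖s.prod‖ ≤ c ^ s.card := by
  induction s using Multiset.induction_on with
  | empty => simp
  | cons a s ih =>
    rw [Multiset.prod_cons, norm_mul, Multiset.card_cons, pow_succ']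
    have ha := h a (by simp)
    exact mul_le_mul ha (ih fun z hz => h z (by simp [hz])) (norm_nonneg _)
      ((norm_nonneg _).trans ha)

/-- A bound for the determinant of a sesquilinear form which is bounded with respect to two
Hermitian norms. -/
theorem norm_det_sq_le {P Q : Matrix κ κ ℂ} (hP : P.PosDef) (hQ : Q.PosDef) (B : Matrix κ κ ℂ)
    (c : ℝ) (hc : 0 ≤ c)
    (h : ∀ x y, ‖herm B x y‖ ^ 2 ≤ c * (herm P x x).re * (herm Q y y).re) :
    ‖B.det‖ ^ 2 ≤ c ^ Fintype.card κ * ‖P.det‖ * ‖Q.det‖ := by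
  have hPu := (Matrix.isUnit_iff_isUnit_det _).1 hP.isUnit
  have hQu := (Matrix.isUnit_iff_isUnit_det _).1 hQ.isUnit
  -- The composite of `B` with its adjoint for the metrics `P` and `Q`. Its eigenvalues are the
  -- squared singular values of `B`, to be bounded by `c`, and its determinant has modulus `‖det B‖
  -- ^ 2 / (‖det P‖ ‖det Q‖)`.
  set N := Q⁻¹ * (Bᴴ * (P⁻¹ * B)) with hN
  have hroot : ∀ μ ∈ N.charpoly.roots, ‖μ‖ ≤ c := by
    intro μ hμ
    have hdet : (Matrix.scalar κ μ - N).det = 0 := by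
      rw [← Matrix.eval_charpoly]; exact Polynomial.isRoot_of_mem_roots hμ
    obtain ⟨y, hy0, hy⟩ := Matrix.exists_mulVec_eq_zero_iff.2 hdet
    have hNy : N *ᵥ y = μ • y := by
      rw [Matrix.sub_mulVec, sub_eq_zero] at hy
      rw [← hy]; simp
    -- This `x` represents `B y` for the metric `P`. For an eigenvector `y`, both `P(x, x)` and `‖μ‖
    -- Q(y, y)` equal `‖B(x, y)‖`, so the bound at `(x, y)` controls `μ`.
    set x := P⁻¹ *ᵥ (B *ᵥ y) with hx
    have h1 : herm B x y = herm P x x := by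
      rw [herm, herm]
      congr 1
      rw [hx, Matrix.mulVec_mulVec, Matrix.mul_nonsing_inv _ hPu, Matrix.one_mulVec]
    have h2 : star (herm B x y) = μ * herm Q y y := by
      rw [star_herm, ← herm_smul_right, ← hNy, herm_mulVec_right N, hN, ← mul_assoc Q,
        Matrix.mul_nonsing_inv _ hQu, one_mul, hx, Matrix.mulVec_mulVec, herm_mulVec_right]
    have hq := herm_pos hQ hy0
    have hp := herm_nonneg hP x
    rw [h1, ← herm_self hP.1, ← herm_self hQ.1 y] at h2
    have h3 : (herm P x x).re = ‖μ‖ * (herm Q y y).re := by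
      have := congrArg norm h2
      rwa [norm_star, norm_mul, Complex.norm_real, Complex.norm_real, Real.norm_of_nonneg hp,
        Real.norm_of_nonneg hq.le] at this
    have h4 := h x y
    rw [h1, ← herm_self hP.1, Complex.norm_real, Real.norm_of_nonneg hp, Complex.ofReal_re] at h4
    rcases hp.eq_or_lt with h0 | h0
    · have : ‖μ‖ = 0 := by
        rw [← h0] at h3
        rcases mul_eq_zero.1 h3.symm with h | h
        · exact h
        · exact absurd h hq.ne'
      rw [this]; exact hc
    · have h5 : (herm P x x).re ≤ c * (herm Q y y).re := by
        nlinarith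
      rw [h3] at h5
      exact le_of_mul_le_mul_right h5 hq
  have hdetN : ‖N.det‖ ≤ c ^ Fintype.card κ := by
    rw [Matrix.det_eq_prod_roots_charpoly]
    refine (norm_multiset_prod_le _ c hroot).trans_eq ?_
    rw [← N.charpoly_natDegree_eq_dim, IsAlgClosed.card_roots_eq_natDegree]
  rw [hN, Matrix.det_mul, Matrix.det_mul, Matrix.det_mul, Matrix.det_nonsing_inv,
    Matrix.det_nonsing_inv, Ring.inverse_eq_inv', Matrix.det_conjTranspose,
    norm_mul, norm_mul, norm_mul, norm_star, norm_inv, norm_inv] at hdetN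
  have hp0 : 0 < ‖P.det‖ := norm_pos_iff.2 hPu.ne_zero
  have hq0 : 0 < ‖Q.det‖ := norm_pos_iff.2 hQu.ne_zero
  calc ‖B.det‖ ^ 2 = ‖Q.det‖⁻¹ * (‖B.det‖ * (‖P.det‖⁻¹ * ‖B.det‖)) * (‖P.det‖ * ‖Q.det‖) := by
        field_simp
    _ ≤ c ^ Fintype.card κ * (‖P.det‖ * ‖Q.det‖) := by gcongr
    _ = _ := by ring

/-- The Schur complement of a positive definite block matrix. -/
theorem exists_schur {P : Matrix (ι ⊕ κ) (ι ⊕ κ) ℂ} (hP : P.PosDef) :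
    ∃ S : Matrix κ κ ℂ, S.PosDef ∧ P.det = P.toBlocks₁₁.det * S.det ∧
      ∀ y, ∃ x, herm P (Sum.elim x y) (Sum.elim x y) = herm S y y := by
  have h11 : P.toBlocks₁₁.PosDef := hP.submatrix (e := Sum.inl) Sum.inl_injective
  have hinv : Invertible P.toBlocks₁₁ := h11.isUnit.invertible
  have h21 : P.toBlocks₂₁ = P.toBlocks₁₂ᴴ := by
    ext i j
    exact (hP.1.apply (Sum.inr i) (Sum.inl j)).symm
  have hPb : P = Matrix.fromBlocks P.toBlocks₁₁ P.toBlocks₁₂ P.toBlocks₁₂ᴴ P.toBlocks₂₂ := by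
    rw [← h21, Matrix.fromBlocks_toBlocks]
  set S := P.toBlocks₂₂ - P.toBlocks₁₂ᴴ * P.toBlocks₁₁⁻¹ * P.toBlocks₁₂ with hS
  -- The lift of `y` orthogonal to the first block has its norm given by `S`, which is thus the
  -- quotient metric.
  have hval : ∀ y, herm P (Sum.elim (-((P.toBlocks₁₁⁻¹ * P.toBlocks₁₂) *ᵥ y)) y)
      (Sum.elim (-((P.toBlocks₁₁⁻¹ * P.toBlocks₁₂) *ᵥ y)) y) = herm S y y := by
    intro y
    have h := Matrix.schur_complement_eq₁₁ P.toBlocks₁₂ P.toBlocks₂₂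
      (-((P.toBlocks₁₁⁻¹ * P.toBlocks₁₂) *ᵥ y)) y h11.1
    rw [← hPb, neg_add_cancel, dotProduct_zero, zero_add, ← Matrix.dotProduct_mulVec,
      ← Matrix.dotProduct_mulVec] at h
    exact h
  refine ⟨S, ?_, ?_, fun y => ⟨_, hval y⟩⟩
  · refine Matrix.PosDef.of_dotProduct_mulVec_pos ?_ fun y hy => ?_
    · rw [← Matrix.IsHermitian.fromBlocks₁₁ _ _ h11.1, ← hPb]; exact hP.1
    · change 0 < herm S y y
      rw [← hval y]
      refine hP.dotProduct_mulVec_pos fun h => hy ?_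
      ext k
      exact congrFun h (Sum.inr k)
  · conv_lhs => rw [hPb]
    rw [Matrix.det_fromBlocks₁₁, Matrix.invOf_eq_nonsing_inv]

/-- The form is trivial on the first block, so it can be evaluated on orthogonal lifts, where `P`
and `Q` become their quotient metrics. These have determinants `det P / det P₁₁` and `det Q / det
Q₁₁`. -/
theorem norm_det_sq_mul_le {P Q : Matrix (ι ⊕ κ) (ι ⊕ κ) ℂ} (hP : P.PosDef) (hQ : Q.PosDef)
    (B : Matrix κ κ ℂ) (c : ℝ) (hc : 0 ≤ c)
    (h : ∀ x y, ‖herm (Matrix.fromBlocks 0 0 0 B) x y‖ ^ 2 ≤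
      c * (herm P x x).re * (herm Q y y).re) :
    ‖B.det‖ ^ 2 * (‖P.toBlocks₁₁.det‖ * ‖Q.toBlocks₁₁.det‖) ≤
      c ^ Fintype.card κ * ‖P.det‖ * ‖Q.det‖ := by
  obtain ⟨S, hS, hPS, hSx⟩ := exists_schur hP
  obtain ⟨T, hT, hQT, hTy⟩ := exists_schur hQ
  have key := norm_det_sq_le hS hT B c hc fun x y => by
    obtain ⟨x', hx'⟩ := hSx x
    obtain ⟨y', hy'⟩ := hTy y
    rw [← hx', ← hy']
    have h1 := h (Sum.elim x' x) (Sum.elim y' y)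
    have h2 : herm (Matrix.fromBlocks 0 0 0 B) (Sum.elim x' x) (Sum.elim y' y) = herm B x y := by
      simp [herm, Matrix.fromBlocks_mulVec, dotProduct, Fintype.sum_sum_type]
    rwa [h2] at h1
  rw [hPS, hQT, norm_mul, norm_mul]
  calc _ ≤ (c ^ Fintype.card κ * ‖S.det‖ * ‖T.det‖) * (‖P.toBlocks₁₁.det‖ * ‖Q.toBlocks₁₁.det‖) := by
        gcongr
    _ = _ := by ring

/-- A Hermitian form is determined by its values on the diagonal. -/
theorem eq_of_herm_self {M N : Matrix κ κ ℂ} (h : ∀ x, herm M x x = herm N x x) : M = N := by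
  have h0 : ∀ x y, herm (M - N) x y = 0 := by
    have hd : ∀ x, herm (M - N) x x = 0 := fun x => by
      rw [herm, Matrix.sub_mulVec, dotProduct_sub, sub_eq_zero]; exact h x
    intro x y
    have h1 := hd (x + y)
    have h2 := hd (x + Complex.I • y)
    simp only [herm_add_left, herm_add_right, herm_smul_left, herm_smul_right] at h1 h2
    simp only [hd, RCLike.star_def, Complex.conj_I] at h1 h2
    have h3 : herm (M - N) x y - herm (M - N) y x = 0 := by
      have : Complex.I * (herm (M - N) x y - herm (M - N) y x) = 0 := by linear_combination h2
      exact (mul_eq_zero.1 this).resolve_left Complex.I_ne_zero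
    linear_combination (h1 + h3) / 2
  rw [← sub_eq_zero]
  ext i j
  have := h0 (Pi.single i 1) (Pi.single j 1)
  have h5 : star (Pi.single i (1 : ℂ) : κ → ℂ) = Pi.single i 1 := by
    ext k; by_cases hk : k = i
    · subst hk; simp
    · simp [hk]
  rw [herm, h5, single_one_dotProduct, Matrix.mulVec_single_one] at this
  simpa using this

section Isometry

variable {P Q γ : Matrix κ κ ℂ} {c : ℝ}

/-- The determinant of a form which is a similarity. -/
theorem norm_det_sq_eq (hQ : Q.PosDef) (hc : 0 ≤ c)
    (h : ∀ x, herm (γ * Q⁻¹ * γᴴ) x x = c * herm P x x) :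
    ‖γ.det‖ ^ 2 = c ^ Fintype.card κ * ‖P.det‖ * ‖Q.det‖ := by
  have hQu := (Matrix.isUnit_iff_isUnit_det _).1 hQ.isUnit
  have h1 : γ * Q⁻¹ * γᴴ = (c : ℂ) • P := eq_of_herm_self fun x => by
    rw [h, herm, herm, Matrix.smul_mulVec, dotProduct_smul, smul_eq_mul]
  have h2 := congrArg (fun A : Matrix κ κ ℂ => ‖A.det‖) h1
  simp only [Matrix.det_mul, Matrix.det_smul, Matrix.det_nonsing_inv, Ring.inverse_eq_inv',
    Matrix.det_conjTranspose, norm_mul, norm_star, norm_inv, norm_pow, Complex.norm_real,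
    Real.norm_of_nonneg hc] at h2
  rw [← h2]
  have hq0 : ‖Q.det‖ ≠ 0 := norm_ne_zero_iff.2 hQu.ne_zero
  field_simp

/-- The functional `γ(x, ·)` is represented for `Q` by `Q⁻¹ γᴴ x`, whose squared norm is `c P(x, x)`
by the similarity. Cauchy-Schwarz concludes. -/
theorem norm_herm_sq_le_of_similarity (hQ : Q.PosDef)
    (h : ∀ x, herm (γ * Q⁻¹ * γᴴ) x x = c * herm P x x) (x y : κ → ℂ) :
    ‖herm γ x y‖ ^ 2 ≤ c * (herm P x x).re * (herm Q y y).re := by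
  have hQu := (Matrix.isUnit_iff_isUnit_det _).1 hQ.isUnit
  have h1 : herm γ x y = herm Q ((Q⁻¹ * γᴴ) *ᵥ x) y := by
    rw [herm_mulVec_left, Matrix.conjTranspose_mul, Matrix.conjTranspose_conjTranspose,
      Matrix.conjTranspose_nonsing_inv, hQ.1.eq, mul_assoc, Matrix.nonsing_inv_mul _ hQu, mul_one]
  have h2 : (herm Q ((Q⁻¹ * γᴴ) *ᵥ x) ((Q⁻¹ * γᴴ) *ᵥ x)).re = c * (herm P x x).re := by
    rw [← Complex.re_ofReal_mul, ← h, herm_mulVec_left, herm_mulVec_right,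
      Matrix.conjTranspose_mul, Matrix.conjTranspose_conjTranspose,
      Matrix.conjTranspose_nonsing_inv, hQ.1.eq, mul_assoc γ, Matrix.nonsing_inv_mul _ hQu, mul_one,
      mul_assoc]
  rw [h1, ← h2]
  exact norm_herm_sq_le hQ _ _

end Isometry

end Matrices

/-! ### From vectors over a completion to complex vectors -/

section Complexify

open scoped ComplexOrder Matrix

variable {K : Type*} [Field K] [NumberField K] {κ : Type*} [Fintype κ]

/-- The image in `ℂ` of a vector with coordinates in the completion at an infinite place. -/
def emb (v : InfinitePlace K) (x : κ → v.Completion) : κ → ℂ := fun i => extensionEmbedding v (x i)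

omit [NumberField K] [Fintype κ] in
theorem star_emb_of_isReal {v : InfinitePlace K} (hv : v.IsReal) (x : κ → v.Completion) :
    star (emb v x) = emb v x := by
  ext i
  change starRingEnd ℂ (extensionEmbedding v (x i)) = extensionEmbedding v (x i)
  rw [← extensionEmbeddingOfIsReal_apply hv, Complex.conj_ofReal]

omit [NumberField K] [Fintype κ] in
theorem exists_emb_eq_of_isReal {v : InfinitePlace K} (hv : v.IsReal) (w : κ → ℂ)
    (hw : star w = w) : ∃ x : κ → v.Completion, emb v x = w := by
  choose x hx using fun i => surjective_extensionEmbeddingOfIsReal hv (w i).re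
  refine ⟨x, funext fun i => ?_⟩
  rw [emb, ← extensionEmbeddingOfIsReal_apply hv, hx]
  exact Complex.conj_eq_iff_re.1 (congrFun hw i)

omit [NumberField K] [Fintype κ] in
theorem exists_emb_eq_of_isComplex {v : InfinitePlace K} (hv : v.IsComplex) (w : κ → ℂ) :
    ∃ x : κ → v.Completion, emb v x = w := by
  choose x hx using fun i => surjective_extensionEmbedding_of_isComplex hv (w i)
  exact ⟨x, funext hx⟩

omit [NumberField K] in
/-- A Hermitian form which is real at a real place splits along real and imaginary parts. -/
theorem exists_herm_split (v : InfinitePlace K) (A : Matrix κ κ ℂ) (hA : A.IsHermitian)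
    (hr : v.IsReal → Aᴴ = Aᵀ) (w : κ → ℂ) : ∃ x y : κ → v.Completion,
      herm A w w = herm A (emb v x) (emb v x) + herm A (emb v y) (emb v y) ∧
        (w ≠ 0 → x ≠ 0 ∨ y ≠ 0) := by
  have emb_zero : emb v (0 : κ → v.Completion) = 0 := funext fun i => map_zero _
  rcases v.isReal_or_isComplex with hv | hv
  · obtain ⟨x, hx⟩ := exists_emb_eq_of_isReal hv (fun i => ((w i).re : ℂ))
      (funext fun i => Complex.conj_ofReal _)
    obtain ⟨y, hy⟩ := exists_emb_eq_of_isReal hv (fun i => ((w i).im : ℂ))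
      (funext fun i => Complex.conj_ofReal _)
    have hw : w = emb v x + Complex.I • emb v y := by
      rw [hx, hy]; ext i
      simp only [Pi.add_apply, Pi.smul_apply, smul_eq_mul, mul_comm Complex.I, Complex.re_add_im]
    have hAt : Aᵀ = A := by rw [← hr hv, hA.eq]
    -- The matrix is symmetric and both vectors are real, so the two cross terms agree and cancel in
    -- the expansion.
    have hcross : herm A (emb v x) (emb v y) = herm A (emb v y) (emb v x) := by
      rw [herm, herm, star_emb_of_isReal hv, star_emb_of_isReal hv, Matrix.dotProduct_mulVec,
        dotProduct_comm, ← Matrix.mulVec_transpose, hAt]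
    refine ⟨x, y, ?_, fun h0 => ?_⟩
    · conv_lhs => rw [hw]
      simp only [herm_add_left, herm_add_right, herm_smul_left, herm_smul_right, hcross,
        RCLike.star_def, Complex.conj_I]
      linear_combination -(herm A (emb v y) (emb v y)) * Complex.I_mul_I
    · by_contra! h
      rw [h.1, h.2, emb_zero, smul_zero, add_zero] at hw
      exact h0 hw
  · obtain ⟨x, hx⟩ := exists_emb_eq_of_isComplex hv w
    refine ⟨x, 0, ?_, fun h0 => Or.inl ?_⟩
    · rw [emb_zero, herm_zero_right, add_zero, hx]
    · rintro rfl
      exact h0 (by rw [← hx, emb_zero])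

end Complexify

/-! ### Gram matrices and operator norms at the infinite places -/

section Gram

open scoped ComplexOrder Matrix

variable {K E : Type*} [Field K] [NumberField K] [AddCommGroup E] [Module K E]
  [Module (𝓞 K) E] [IsScalarTower (𝓞 K) K E] {κ : Type*} [Fintype κ]

/-- The Gram matrix of a family of vectors at an infinite place. -/
def RigidAdelicSpace.gram (V : RigidAdelicSpace K E) (v : InfinitePlace K) (f : κ → E) :
    Matrix κ κ ℂ := Matrix.of fun i j => V.form v (1 ⊗ₜ[K] f i) (1 ⊗ₜ[K] f j)

/-- The vector of `K_v ⊗ E` with given coordinates. -/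
def vec (v : InfinitePlace K) (f : κ → E) (x : κ → v.Completion) : v.Completion ⊗[K] E :=
  ∑ i, x i ⊗ₜ f i

variable (V : RigidAdelicSpace K E) (v : InfinitePlace K)

theorem form_vec (f : κ → E) (x y : κ → v.Completion) :
    V.form v (vec v f x) (vec v f y) = herm (V.gram v f) (emb v x) (emb v y) := by
  have h : ∀ x : κ → v.Completion, vec v f x = ∑ i, x i • ((1 : v.Completion) ⊗ₜ[K] f i) := fun x => by
    simp only [vec, TensorProduct.smul_tmul', smul_eq_mul, mul_one]
  rw [h, h]
  simp only [map_sum, LinearMap.sum_apply, map_smulₛₗ, LinearMap.smul_apply, smul_eq_mul,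
    herm, dotProduct, Matrix.mulVec, Finset.mul_sum]
  rw [Finset.sum_comm]
  refine Finset.sum_congr rfl fun i _ => Finset.sum_congr rfl fun j _ => ?_
  simp only [emb, RigidAdelicSpace.gram, Matrix.of_apply, Pi.star_apply, RCLike.star_def,
    RingHom.comp_apply]
  ring

omit [NumberField K] [Module (𝓞 K) E] [IsScalarTower (𝓞 K) K E] in
theorem vec_surjective (e : Basis κ K E) (X : v.Completion ⊗[K] E) : ∃ x, X = vec v e x := by
  refine ⟨fun i => (e.baseChange v.Completion).repr X i, ?_⟩
  conv_lhs => rw [← (e.baseChange v.Completion).sum_repr X]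
  simp only [vec, Basis.baseChange_apply, TensorProduct.smul_tmul', smul_eq_mul, mul_one]

omit [NumberField K] [Module (𝓞 K) E] [IsScalarTower (𝓞 K) K E] in
theorem vec_ne_zero (e : Basis κ K E) {x : κ → v.Completion} (hx : x ≠ 0) : vec v e x ≠ 0 := by
  intro h
  apply hx
  have h1 : ∑ i, x i • e.baseChange v.Completion i = 0 := by
    rw [← h]
    simp only [vec, Basis.baseChange_apply, TensorProduct.smul_tmul', smul_eq_mul, mul_one]
  exact funext (Fintype.linearIndependent_iff.1 (e.baseChange v.Completion).linearIndependent x h1)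

omit [Fintype κ] in
theorem gram_isHermitian (f : κ → E) : (V.gram v f).IsHermitian := by
  ext i j
  exact V.form_symm v _ _

omit [Fintype κ] in
theorem gram_conjTranspose_eq (hv : v.IsReal) (f : κ → E) :
    (V.gram v f)ᴴ = (V.gram v f)ᵀ := by
  ext i j
  exact Complex.conj_eq_iff_im.2 (V.form_real v hv _ _)

/-- `form_pos` concerns vectors over `K_v` only. At a complex place these give all complex vectors;
at a real place a complex vector splits into real and imaginary parts. -/
theorem gram_posDef (e : Basis κ K E) : (V.gram v e).PosDef := by
  refine Matrix.PosDef.of_dotProduct_mulVec_pos (gram_isHermitian V v e) fun w hw => ?_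
  change 0 < herm (V.gram v e) w w
  obtain ⟨x, y, h, h0⟩ := exists_herm_split v _ (gram_isHermitian V v e)
    (fun hv => gram_conjTranspose_eq V v hv e) w
  have hpos : ∀ x : κ → v.Completion, x ≠ 0 →
      0 < (herm (V.gram v e) (emb v x) (emb v x)).re := fun x hx => by
    rw [← form_vec]; exact V.form_pos v _ (vec_ne_zero v e hx)
  have hnn : ∀ x : κ → v.Completion, 0 ≤ (herm (V.gram v e) (emb v x) (emb v x)).re := fun x => by
    by_cases hx : x = 0
    · rw [hx, show emb v (0 : κ → v.Completion) = 0 from funext fun i => map_zero _,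
        herm_zero_right]; simp
    · exact (hpos x hx).le
  rw [← herm_self (gram_isHermitian V v e), Complex.zero_lt_real, h, Complex.add_re]
  rcases h0 hw with hx | hy
  · have := hpos x hx; have := hnn y; linarith
  · have := hpos y hy; have := hnn x; linarith

theorem gram_det_re (e : Basis κ K E) [DecidableEq κ] :
    (V.gram v e).det.re = ‖(V.gram v e).det‖ := by
  have h := Complex.lt_def.1 (gram_posDef V v e).det_pos
  have h2 : ((V.gram v e).det.re : ℂ) = (V.gram v e).det :=
    Complex.ext rfl (by simpa using h.2)
  conv_rhs => rw [← h2]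
  rw [Complex.norm_real, Real.norm_of_nonneg h.1.le]

variable [DecidableEq κ]

/-- The operator norm of a linear form at an infinite place, in coordinates. -/
theorem sSup_norm_div_eq (e : Basis κ K E) (ω : v.Completion ⊗[K] E →ₗ[v.Completion] v.Completion)
    (u : κ → ℂ) (hu : ∀ i, star (u i) = extensionEmbedding v (ω (1 ⊗ₜ e i))) :
    sSup {r : ℝ | ∃ X : v.Completion ⊗[K] E, X ≠ 0 ∧ r = ‖ω X‖ / √(V.form v X X).re} =
      √(herm (V.gram v e)⁻¹ u u).re := by
  set G := V.gram v e with hG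
  have hGp : G.PosDef := gram_posDef V v e
  have hGu := (Matrix.isUnit_iff_isUnit_det _).1 hGp.isUnit
  -- Riesz representation: `ω` is the product with `G⁻¹ u`, the conjugation in `hu` coming from
  -- antilinearity in the first variable. The norm is then bounded by Cauchy-Schwarz and attained at
  -- `G⁻¹ u`.
  have hωx : ∀ x, extensionEmbedding v (ω (vec v e x)) = herm G (G⁻¹ *ᵥ u) (emb v x) := by
    intro x
    rw [herm_mulVec_left, Matrix.conjTranspose_nonsing_inv, hGp.1.eq,
      Matrix.nonsing_inv_mul _ hGu, herm, Matrix.one_mulVec, vec, map_sum, map_sum]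
    refine Finset.sum_congr rfl fun i _ => ?_
    rw [Pi.star_apply, hu, show x i ⊗ₜ[K] e i = x i • ((1 : v.Completion) ⊗ₜ[K] e i) by
      rw [TensorProduct.smul_tmul', smul_eq_mul, mul_one], map_smul, smul_eq_mul, map_mul, mul_comm]
    rfl
  have hnorm : ∀ z : v.Completion, ‖z‖ = ‖extensionEmbedding v z‖ := fun z =>
    ((AddMonoidHomClass.isometry_iff_norm (extensionEmbedding v)).1
      (isometry_extensionEmbedding v) z).symm
  have hr : herm G (G⁻¹ *ᵥ u) (G⁻¹ *ᵥ u) = herm G⁻¹ u u := by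
    rw [herm_mulVec_left, herm_mulVec_right, Matrix.conjTranspose_nonsing_inv, hGp.1.eq,
      Matrix.nonsing_inv_mul _ hGu, one_mul]
  set r := √(herm G⁻¹ u u).re with hrdef
  have hle : ∀ X : v.Completion ⊗[K] E, X ≠ 0 → ‖ω X‖ / √(V.form v X X).re ≤ r := by
    intro X hX
    obtain ⟨x, rfl⟩ := vec_surjective v e X
    have hpos := V.form_pos v _ hX
    rw [form_vec] at hpos ⊢
    rw [div_le_iff₀ (Real.sqrt_pos.2 hpos), hnorm, hωx, hrdef, ← hr,
      ← Real.sqrt_mul (herm_nonneg hGp _)]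
    exact Real.le_sqrt_of_sq_le (norm_herm_sq_le hGp _ _)
  apply le_antisymm
  · refine Real.sSup_le ?_ (Real.sqrt_nonneg _)
    rintro _ ⟨X, hX, rfl⟩
    exact hle X hX
  -- If `r = 0` the representing vector is zero and cannot be tested in the supremum, but then the
  -- bound is trivial.
  · by_cases hr0 : r = 0
    · rw [hr0]
      refine Real.sSup_nonneg ?_
      rintro _ ⟨X, hX, rfl⟩
      positivity
    -- The extremal vector must come from `K_v`. At a real place this holds because `G` and `u` are
    -- real.
    · have hex : ∃ x : κ → v.Completion, emb v x = G⁻¹ *ᵥ u := by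
        rcases v.isReal_or_isComplex with hv | hv
        · refine exists_emb_eq_of_isReal hv _ ?_
          have hstar : star u = u := by
            ext i
            have h1 := hu i
            rw [← extensionEmbeddingOfIsReal_apply hv] at h1
            rw [Pi.star_apply]
            have h2 := congrArg star h1
            rw [star_star] at h2
            rw [h1, h2, RCLike.star_def, Complex.conj_ofReal]
          rw [Matrix.star_mulVec, hstar, Matrix.conjTranspose_nonsing_inv,
            hG, gram_conjTranspose_eq V v hv, ← Matrix.transpose_nonsing_inv,
            Matrix.vecMul_transpose]
        · exact exists_emb_eq_of_isComplex hv _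
      obtain ⟨x, hx⟩ := hex
      have hx0 : x ≠ 0 := by
        rintro rfl
        apply hr0
        rw [hrdef, ← hr, ← hx, show emb v (0 : κ → v.Completion) = 0 from
          funext fun i => map_zero _, herm_zero_right]
        simp
      refine le_csSup ⟨r, ?_⟩ ⟨vec v e x, vec_ne_zero v e hx0, ?_⟩
      · rintro _ ⟨X, hX, rfl⟩
        exact hle X hX
      · rw [form_vec, hnorm, hωx, hx, hr, ← hrdef,
          show herm G⁻¹ u u = ((herm G⁻¹ u u).re : ℂ) from (herm_self hGp.1.inv u).symm,
          Complex.norm_real, Real.norm_of_nonneg (herm_nonneg hGp.inv u),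
          ← Real.sq_sqrt (herm_nonneg hGp.inv u), ← hrdef, sq, mul_div_cancel_right₀ _ hr0]

end Gram

/-! ### Similarities with the dual at the infinite places -/

section ArchDuality

open scoped ComplexOrder Matrix

variable {K E : Type*} [Field K] [NumberField K] [AddCommGroup E] [Module K E]
  [Module (𝓞 K) E] [IsScalarTower (𝓞 K) K E]

section

variable {κ : Type*} [Fintype κ] [DecidableEq κ]
  (V : RigidAdelicSpace K E) (v : InfinitePlace K)

/-- The matrix of a form in a basis, embedded in `ℂ` through an infinite place. -/
def formMatrix (e : κ → E) (B : E → E → K) : Matrix κ κ ℂ :=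
  Matrix.of fun i j => v.embedding (B (e i) (e j))

omit [NumberField K] [AddCommGroup E] [Module K E] [Module (𝓞 K) E] [IsScalarTower (𝓞 K) K E]
  [Fintype κ] [DecidableEq κ] in
theorem formMatrix_conjTranspose_eq (hv : v.IsReal) (e : κ → E) (B : E → E → K) :
    (formMatrix v e B)ᴴ = (formMatrix v e B)ᵀ := by
  ext i j
  exact RingHom.congr_fun (InfinitePlace.isReal_iff.1 hv) (B (e j) (e i))

/-- The difference of the two sides is Hermitian, and real at a real place, so it splits over
vectors coming from `K_v`, where it vanishes. -/
theorem herm_eq_of_emb (e : Basis κ K E) (γ P : Matrix κ κ ℂ) (c : ℝ)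
    (hγ : v.IsReal → γᴴ = γᵀ) (hP : P.IsHermitian) (hPr : v.IsReal → Pᴴ = Pᵀ)
    (h : ∀ x, (herm (γ * (V.gram v e)⁻¹ * γᴴ) (emb v x) (emb v x)).re =
      c * (herm P (emb v x) (emb v x)).re) (w : κ → ℂ) :
    herm (γ * (V.gram v e)⁻¹ * γᴴ) w w = c * herm P w w := by
  set G := V.gram v e with hG
  have hN : (γ * G⁻¹ * γᴴ).IsHermitian :=
    Matrix.isHermitian_mul_mul_conjTranspose γ (gram_isHermitian V v e).inv
  have hsub : ∀ w, herm (γ * G⁻¹ * γᴴ - (c : ℂ) • P) w w =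
      herm (γ * G⁻¹ * γᴴ) w w - c * herm P w w := fun w => by
    rw [herm, Matrix.sub_mulVec, dotProduct_sub, Matrix.smul_mulVec, dotProduct_smul, smul_eq_mul]
    rfl
  have hA : (γ * G⁻¹ * γᴴ - (c : ℂ) • P).IsHermitian := by
    refine hN.sub ?_
    rw [Matrix.IsHermitian, Matrix.conjTranspose_smul, hP.eq, RCLike.star_def, Complex.conj_ofReal]
  have hAr : v.IsReal → (γ * G⁻¹ * γᴴ - (c : ℂ) • P)ᴴ = (γ * G⁻¹ * γᴴ - (c : ℂ) • P)ᵀ := by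
    intro hv
    have h1 : γᵀᴴ = γ := by rw [← hγ hv, Matrix.conjTranspose_conjTranspose]
    rw [Matrix.conjTranspose_sub, Matrix.transpose_sub, Matrix.conjTranspose_smul,
      Matrix.transpose_smul, RCLike.star_def, Complex.conj_ofReal, hPr hv, hγ hv]
    simp only [Matrix.conjTranspose_mul, Matrix.transpose_mul, h1, hγ hv,
      Matrix.transpose_transpose]
    rw [Matrix.conjTranspose_nonsing_inv, hG, gram_conjTranspose_eq V v hv,
      Matrix.transpose_nonsing_inv]
  have h0 : ∀ x, herm (γ * G⁻¹ * γᴴ - (c : ℂ) • P) (emb v x) (emb v x) = 0 := fun x => by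
    rw [hsub, ← herm_self hN, ← herm_self hP, h]
    push_cast; ring
  obtain ⟨x, y, hxy, -⟩ := exists_herm_split v _ hA hAr w
  rw [h0, h0, add_zero, hsub, sub_eq_zero] at hxy
  exact hxy

omit [NumberField K] [Fintype κ] [DecidableEq κ] in
theorem exists_star_emb (x : κ → v.Completion) : ∃ y : κ → v.Completion,
    star (emb v y) = emb v x := by
  rcases v.isReal_or_isComplex with hv | hv
  · exact ⟨x, star_emb_of_isReal hv x⟩
  · obtain ⟨y, hy⟩ := exists_emb_eq_of_isComplex hv (star (emb v x))
    exact ⟨y, by rw [hy, star_star]⟩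

omit [DecidableEq κ] in
theorem herm_transpose (G : Matrix κ κ ℂ) (x : κ → ℂ) :
    herm Gᵀ (star x) (star x) = herm G x x := by
  rw [herm, herm, star_star, Matrix.mulVec_transpose, dotProduct_comm, Matrix.dotProduct_mulVec]

omit [NumberField K] [Module (𝓞 K) E] [IsScalarTower (𝓞 K) K E] [DecidableEq κ] in
theorem evalAt_sum_tmul (x : κ → v.Completion) (φ : κ → Dual K E) (y : E) :
    extensionEmbedding v (evalAt v.Completion (∑ i, x i ⊗ₜ[K] φ i) (1 ⊗ₜ y)) =
      ∑ i, emb v x i * v.embedding (φ i y) := by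
  rw [map_sum, LinearMap.sum_apply, map_sum]
  refine Finset.sum_congr rfl fun i _ => ?_
  rw [evalAt, LinearMap.liftBaseChange_tmul, LinearMap.smul_apply, Dual.baseChange_apply_tmul,
    smul_eq_mul, map_mul, ← Algebra.algebraMap_eq_smul_one]
  congr 1
  simp

theorem herm_eq_of_archNorm (e : Basis κ K E) (ω : v.Completion ⊗[K] Dual K E)
    (x : κ → v.Completion) (lam : ℝ) (u : κ → ℂ)
    (hu : ∀ i, star (u i) = extensionEmbedding v (evalAt v.Completion ω (1 ⊗ₜ e i)))
    (h : V.toAdelicData.dual.archNorm v ω = lam * V.toAdelicData.archNorm v (vec v e x)) :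
    (herm (V.gram v e)⁻¹ u u).re = lam ^ 2 * (herm (V.gram v e) (emb v x) (emb v x)).re := by
  have hG := gram_posDef V v e
  have h1 : √(herm (V.gram v e)⁻¹ u u).re =
      lam * √(herm (V.gram v e) (emb v x) (emb v x)).re := by
    rw [← sSup_norm_div_eq V v e _ u hu, ← form_vec]
    exact h
  have h2 := congrArg (· ^ 2) h1
  simp only [mul_pow] at h2
  rwa [Real.sq_sqrt (herm_nonneg hG.inv u), Real.sq_sqrt (herm_nonneg hG _)] at h2

/-- The coordinates of `σ(x)` are linear in `x`, while the Riesz vector of a functional is conjugate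
to its coordinates. The Riesz vector is therefore `γᴴ` applied to `star x`, and rewriting the norm
of `x` in terms of `star x` transposes the Gram matrix. -/
theorem herm_eq_of_isodual (e : Basis κ K E) (σ : E →ₗ[K] Dual K E) (lam : ℝ)
    (h : ∀ X, V.toAdelicData.dual.archNorm v (σ.baseChange v.Completion X) =
      lam * V.toAdelicData.archNorm v X) (w : κ → ℂ) :
    herm (formMatrix v e (fun x y => σ x y) * (V.gram v e)⁻¹ *
      (formMatrix v e (fun x y => σ x y))ᴴ) w w = ((lam ^ 2 : ℝ) : ℂ) * herm (V.gram v e)ᵀ w w := by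
  refine herm_eq_of_emb V v e _ _ _ (fun hv => formMatrix_conjTranspose_eq v hv _ _)
    (gram_isHermitian V v e).transpose (fun hv => ?_) (fun x' => ?_) w
  · rw [Matrix.transpose_transpose, ← gram_conjTranspose_eq V v hv,
      Matrix.conjTranspose_conjTranspose]
  · obtain ⟨x, hx⟩ := exists_star_emb v x'
    rw [← hx, herm_transpose, mul_assoc, ← Matrix.conjTranspose_conjTranspose (formMatrix v e _),
      ← herm_mulVec_left, Matrix.conjTranspose_conjTranspose, ← herm_mulVec_right]
    refine herm_eq_of_archNorm V v e (σ.baseChange v.Completion (vec v e x)) x lam _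
      (fun j => ?_) (h _)
    rw [vec, map_sum]
    simp only [LinearMap.baseChange_tmul]
    rw [evalAt_sum_tmul]
    simp only [Matrix.mulVec, dotProduct, star_sum, star_mul', Matrix.conjTranspose_apply, star_star,
      formMatrix, Matrix.of_apply, Pi.star_apply]
    exact Finset.sum_congr rfl fun i _ => mul_comm _ _

/-- The conjugation in the conjugate dual cancels that of the Riesz vector, so here the Gram matrix
appears without transposition. -/
theorem herm_eq_of_antiIsodual [IsCMField K] (e : Basis κ K E) (σ : E →ₗ[K] Conj K (Dual K E))
    (lam : ℝ) (h : ∀ X, V.toAdelicData.dual.conj.archNorm v (σ.baseChange v.Completion X) =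
      lam * V.toAdelicData.archNorm v X) (w : κ → ℂ) :
    herm (formMatrix v e (fun x y => sesqForm σ x y) * (V.gram v e)⁻¹ *
      (formMatrix v e (fun x y => sesqForm σ x y))ᴴ) w w =
        ((lam ^ 2 : ℝ) : ℂ) * herm (V.gram v e) w w := by
  refine herm_eq_of_emb V v e _ _ _ (fun hv => formMatrix_conjTranspose_eq v hv _ _)
    (gram_isHermitian V v e) (fun hv => gram_conjTranspose_eq V v hv e) (fun x => ?_) w
  rw [mul_assoc, ← Matrix.conjTranspose_conjTranspose (formMatrix v e _),
      ← herm_mulVec_left, Matrix.conjTranspose_conjTranspose, ← herm_mulVec_right]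
  refine herm_eq_of_archNorm V v e
    (conjTensor K (Dual K E) v (σ.baseChange v.Completion (vec v e x))) x lam _
      (fun j => ?_) (h _)
  have h1 : conjTensor K (Dual K E) v (σ.baseChange v.Completion (vec v e x)) =
      ∑ i, completionConj K v (x i) ⊗ₜ[K] Conj.out K (σ (e i)) := by
    rw [vec, map_sum, map_sum]
    refine Finset.sum_congr rfl fun i _ => ?_
    rw [LinearMap.baseChange_tmul]; rfl
  have h2 : ∀ i, emb v (fun i => completionConj K v (x i)) i = star (emb v x i) := fun i =>
    (ringEquivComplexOfIsComplex (IsTotallyComplex.isComplex v)).apply_symm_apply _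
  rw [h1, evalAt_sum_tmul]
  simp only [Matrix.mulVec, dotProduct, star_sum, star_mul', Matrix.conjTranspose_apply, star_star,
      formMatrix, Matrix.of_apply, h2]
  exact Finset.sum_congr rfl fun i _ => mul_comm _ _

end

variable {ι κ ρ : Type*} [Fintype ι] [Fintype κ] [Fintype ρ] [DecidableEq ι] [DecidableEq κ]
  [DecidableEq ρ]

/-- Determinant estimates at an infinite place for a similarity with the dual: an upper bound for
the discriminant on a subspace modulo its radical, and the value of the discriminant. -/
theorem arch_bounds (G P γ : Matrix ((ι ⊕ κ) ⊕ ρ) ((ι ⊕ κ) ⊕ ρ) ℂ) (B : Matrix κ κ ℂ) (lam : ℝ)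
    (hlam : 0 < lam) (hG : G.PosDef) (hP : P = G ∨ P = Gᵀ)
    (h : ∀ w, herm (γ * G⁻¹ * γᴴ) w w = ((lam ^ 2 : ℝ) : ℂ) * herm P w w)
    (hB : γ.toBlocks₁₁ = Matrix.fromBlocks 0 0 0 B) :
    ‖B.det‖ * ‖G.toBlocks₁₁.toBlocks₁₁.det‖ ≤ lam ^ Fintype.card κ * ‖G.toBlocks₁₁.det‖ ∧
      ‖γ.det‖ = lam ^ Fintype.card ((ι ⊕ κ) ⊕ ρ) * ‖G.det‖ := by
  have hPp : P.PosDef := by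
    rcases hP with rfl | rfl
    · exact hG
    · exact hG.transpose
  have h0 : ‖P.det‖ = ‖G.det‖ := by
    rcases hP with rfl | rfl
    · rfl
    · rw [Matrix.det_transpose]
  -- The first block is the metric of the subspace indexed by `ι ⊕ κ`, and its own first block that
  -- of the radical, indexed by `ι`. Transposition preserves both determinants.
  have h1 : ‖P.toBlocks₁₁.det‖ = ‖G.toBlocks₁₁.det‖ := by
    rcases hP with rfl | rfl
    · rfl
    · rw [← Matrix.det_transpose G.toBlocks₁₁]; rfl
  have h2 : ‖P.toBlocks₁₁.toBlocks₁₁.det‖ = ‖G.toBlocks₁₁.toBlocks₁₁.det‖ := by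
    rcases hP with rfl | rfl
    · rfl
    · rw [← Matrix.det_transpose G.toBlocks₁₁.toBlocks₁₁]; rfl
  constructor
  · have hsum : ∀ (M : Matrix ((ι ⊕ κ) ⊕ ρ) ((ι ⊕ κ) ⊕ ρ) ℂ) (x y : ι ⊕ κ → ℂ),
        herm M (Sum.elim x 0) (Sum.elim y 0) = herm M.toBlocks₁₁ x y := fun M x y => by
      simp [herm, dotProduct, Matrix.mulVec, Fintype.sum_sum_type, Matrix.toBlocks₁₁]
    have key := norm_det_sq_mul_le (hPp.submatrix (e := Sum.inl) Sum.inl_injective)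
      (hG.submatrix (e := Sum.inl) Sum.inl_injective) B (lam ^ 2) (sq_nonneg lam) fun x y => by
        have h3 := norm_herm_sq_le_of_similarity hG h (Sum.elim x 0) (Sum.elim y 0)
        rw [hsum, hsum, hsum, hB] at h3
        exact h3
    change ‖B.det‖ ^ 2 * (‖P.toBlocks₁₁.toBlocks₁₁.det‖ * ‖G.toBlocks₁₁.toBlocks₁₁.det‖) ≤
      (lam ^ 2) ^ Fintype.card κ * ‖P.toBlocks₁₁.det‖ * ‖G.toBlocks₁₁.det‖ at key
    rw [h1, h2] at key
    refine le_of_sq_le_sq ?_ (by positivity)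
    calc _ = ‖B.det‖ ^ 2 * (‖G.toBlocks₁₁.toBlocks₁₁.det‖ * ‖G.toBlocks₁₁.toBlocks₁₁.det‖) := by ring
      _ ≤ _ := key
      _ = _ := by ring
  · have key := norm_det_sq_eq hG (sq_nonneg lam) h
    rw [h0] at key
    refine (pow_left_inj₀ (norm_nonneg _) (by positivity) two_ne_zero).1 ?_
    rw [key]; ring

end ArchDuality

/-! ### Heights in a basis and their logarithms -/

section Heights

open scoped ComplexOrder

variable {K E : Type*} [Field K] [NumberField K] [AddCommGroup E] [Module K E]
  [Module (𝓞 K) E] [IsScalarTower (𝓞 K) K E] (V : RigidAdelicSpace K E)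
  {ι : Type*} [Fintype ι] [DecidableEq ι]

theorem detIdeal_eq_latticeDet (b : Basis ι K E) :
    V.detIdeal b = latticeDet V.lattice V.isLattice.fg b := rfl

theorem heightOf_reindex {ι' : Type*} [Fintype ι'] [DecidableEq ι'] (b : Basis ι K E)
    (f : ι ≃ ι') : V.heightOf (b.reindex f) = V.heightOf b := by
  have h1 : V.detIdeal (b.reindex f) = V.detIdeal b := by
    apply FractionalIdeal.coeToSubmodule_injective
    change Submodule.span _ _ = Submodule.span _ _
    congr 1
    ext d
    constructor
    · rintro ⟨x, hx, rfl⟩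
      exact ⟨x ∘ f, fun i => hx _, by rw [Basis.det_reindex]⟩
    · rintro ⟨x, hx, rfl⟩
      refine ⟨x ∘ f.symm, fun i => hx _, ?_⟩
      rw [Basis.det_reindex]
      congr 1
      ext i; simp
  unfold RigidAdelicSpace.heightOf
  rw [h1]
  congr 3
  ext v
  rw [← Matrix.det_submatrix_equiv_self f]
  simp [Matrix.submatrix]

theorem height_eq_heightOf (b : Basis ι K E) : V.height = V.heightOf b := by
  have := V.finite
  let f : ι ≃ Fin (finrank K E) :=
    Fintype.equivOfCardEq (by rw [Fintype.card_fin, finrank_eq_card_basis b])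
  rw [← heightOf_reindex V b f]
  exact V.heightOf_eq _ _

/-- The square of the height, raised to the degree of the field. -/
def sqHeight (b : Basis ι K E) : ℝ :=
  (FractionalIdeal.absNorm (V.detIdeal b) : ℝ) ^ 2 *
    ∏ v : InfinitePlace K, ‖(V.gram v b).det‖ ^ v.mult

theorem norm_gram_det_pos (b : Basis ι K E) (v : InfinitePlace K) : 0 < ‖(V.gram v b).det‖ :=
  norm_pos_iff.2 ((Matrix.isUnit_iff_isUnit_det _).1 (gram_posDef V v b).isUnit).ne_zero

theorem absNorm_detIdeal_pos (b : Basis ι K E) :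
    (0 : ℝ) < FractionalIdeal.absNorm (V.detIdeal b) := by
  have h1 : FractionalIdeal.absNorm (V.detIdeal b) ≠ 0 :=
    FractionalIdeal.absNorm_eq_zero_iff.not.2
      (latticeDet_ne_zero V.lattice V.isLattice.fg V.isLattice.span_eq_top b)
  exact_mod_cast lt_of_le_of_ne (FractionalIdeal.absNorm_nonneg _) h1.symm

theorem sqHeight_pos (b : Basis ι K E) : 0 < sqHeight V b :=
  mul_pos (pow_pos (absNorm_detIdeal_pos V b) 2)
    (Finset.prod_pos fun v _ => pow_pos (norm_gram_det_pos V b v) _)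

theorem height_pos (b : Basis ι K E) : 0 < V.height := by
  rw [height_eq_heightOf V b]
  refine Real.rpow_pos_of_pos (mul_pos (absNorm_detIdeal_pos V b) (Finset.prod_pos fun v _ => ?_)) _
  refine pow_pos (Real.sqrt_pos.2 ?_) _
  exact (norm_gram_det_pos V b v).trans_eq (gram_det_re V v b).symm

/-- The squared height involves no square roots, which suits discriminants; its logarithm makes the
final comparison linear in the dimensions. -/
theorem log_sqHeight (b : Basis ι K E) :
    Real.log (sqHeight V b) = 2 * finrank ℚ K * Real.log V.height := by
  have hd : (finrank ℚ K : ℝ) ≠ 0 := by exact_mod_cast finrank_pos.ne'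
  set T : ℝ := (FractionalIdeal.absNorm (V.detIdeal b) : ℝ) *
    ∏ v : InfinitePlace K, √(V.gram v b).det.re ^ v.mult with hT
  have hTpos : 0 < T := mul_pos (absNorm_detIdeal_pos V b) (Finset.prod_pos fun v _ =>
    pow_pos (Real.sqrt_pos.2 ((norm_gram_det_pos V b v).trans_eq (gram_det_re V v b).symm)) _)
  have h1 : V.height = T ^ (1 / (finrank ℚ K : ℝ)) := height_eq_heightOf V b
  have h2 : sqHeight V b = T ^ 2 := by
    rw [sqHeight, hT, mul_pow, ← Finset.prod_pow]
    congr 1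
    refine Finset.prod_congr rfl fun v _ => ?_
    rw [pow_right_comm, gram_det_re, Real.sq_sqrt (norm_nonneg _)]
  rw [h1, h2, Real.log_rpow hTpos, Real.log_pow]
  push_cast
  field_simp

theorem log_reducedHeight (b : Basis ι K E) :
    Real.log V.reducedHeight = Real.log V.height / Fintype.card ι := by
  rw [RigidAdelicSpace.reducedHeight, Real.log_rpow (height_pos V b), finrank_eq_card_basis b]
  ring

theorem reducedHeight_pos (b : Basis ι K E) : 0 < V.reducedHeight :=
  Real.rpow_pos_of_pos (height_pos V b) _

/-- The radical may be zero, where minimality of the reduced height says nothing; the value `1`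
gives the required bound directly. -/
theorem height_eq_one_of_isEmpty [IsEmpty ι] (b : Basis ι K E) : V.height = 1 := by
  have h1 : V.detIdeal b = 1 := by
    apply FractionalIdeal.coeToSubmodule_injective
    beta_reduce
    rw [FractionalIdeal.coe_one, Submodule.one_eq_span]
    change Submodule.span _ _ = _
    congr 1
    ext d
    simp
  rw [height_eq_heightOf V b, RigidAdelicSpace.heightOf, h1, map_one]
  simp

end Heights

/-! ### Global height inequalities and isotropy -/

section Destabilizing

variable {K E : Type*} [Field K] [NumberField K] [AddCommGroup E] [Module K E]
  [Module (𝓞 K) E] [IsScalarTower (𝓞 K) K E] {τ : K ≃+* K}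

omit [NumberField K] [Module (𝓞 K) E] [IsScalarTower (𝓞 K) K E] in
-- A single basis of `E` extends bases of `F` and `I`, so that the Gram matrices and the matrices of
-- the form are nested blocks.
theorem exists_adapted_basis [Module.Finite K E] {I F : Submodule K E} (hIF : I ≤ F) :
    ∃ (i k r : ℕ) (e : Basis ((Fin i ⊕ Fin k) ⊕ Fin r) K E) (bF : Basis (Fin i ⊕ Fin k) K F)
      (bI : Basis (Fin i) K I), (∀ s, (bF s : E) = e (Sum.inl s)) ∧
        (∀ s, (bI s : E) = e (Sum.inl (Sum.inl s))) := by
  obtain ⟨Q, hQ⟩ := Submodule.exists_isCompl (I.comap F.subtype)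
  obtain ⟨R, hR⟩ := Submodule.exists_isCompl F
  let bI' := finBasis K (I.comap F.subtype)
  let bF := (bI'.prod (finBasis K Q)).map (Submodule.prodEquivOfIsCompl _ _ hQ)
  let e := (bF.prod (finBasis K R)).map (Submodule.prodEquivOfIsCompl _ _ hR)
  refine ⟨_, _, _, e, bF, bI'.map (Submodule.comapSubtypeEquivOfLe hIF), fun s => ?_, fun s => ?_⟩
  · simp [e]
  · simp [e, bF]

theorem restrict_gram (V : RigidAdelicSpace K E) (F : Submodule K E) (v : InfinitePlace K)
    {κ : Type*} (f : κ → F) : (V.restrict F).gram v f = V.gram v (fun s => (f s : E)) := rfl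

omit [NumberField K] [Module (𝓞 K) E] [IsScalarTower (𝓞 K) K E] in
/-- A totally isotropic subspace for a nondegenerate form has at most half the dimension. -/
theorem two_mul_finrank_le [Module.Finite K E] (c : E →ₗ[K] E →ₛₗ[(τ : K →+* K)] K)
    (hinj : ∀ x, c x = 0 → x = 0) (F : Submodule K E) (hF : ∀ x ∈ F, ∀ y ∈ F, c x y = 0) :
    2 * finrank K F ≤ finrank K E := by
  obtain ⟨R, hR⟩ := Submodule.exists_isCompl F
  let b := finBasis K R
  -- As `c` vanishes on `F × F` and has no left kernel, an element of `F` is determined by its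
  -- values against a complement, so `dim F ≤ dim R`.
  let f : F →ₗ[K] (Fin (finrank K R) → K) :=
    { toFun := fun x j => c x (b j)
      map_add' := fun x y => by ext j; simp
      map_smul' := fun a x => by ext j; simp }
  have hf : Function.Injective f := by
    rw [injective_iff_map_eq_zero]
    intro x hx
    have hxb : ∀ j, c x (b j) = 0 := fun j => congrFun hx j
    refine Subtype.ext (hinj _ (LinearMap.ext fun y => ?_))
    obtain ⟨y₁, hy₁, y₂, hy₂, rfl⟩ := Submodule.mem_sup.1
      (hR.sup_eq_top ▸ Submodule.mem_top : y ∈ F ⊔ R)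
    have h2 : y₂ = ∑ j, b.repr ⟨y₂, hy₂⟩ j • (b j : E) := by
      have := congrArg (Subtype.val) (b.sum_repr ⟨y₂, hy₂⟩)
      rw [Submodule.coe_sum] at this
      exact this.symm
    rw [map_add, hF _ x.2 _ hy₁, zero_add, h2, map_sum]
    refine Finset.sum_eq_zero fun j _ => ?_
    rw [map_smulₛₗ, hxb, smul_zero]
  have h1 := LinearMap.finrank_le_finrank_of_injective hf
  rw [finrank_fin_fun] at h1
  have h2 := Submodule.finrank_add_eq_of_isCompl hR
  omega

/-- The discriminant of the form modulo its radical bounds the height from below. -/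
theorem sqHeight_le_of_radical (V : RigidAdelicSpace K E) (F I : Submodule K E) (hIF : I ≤ F)
    {ι κ : Type*} [Fintype ι] [DecidableEq ι] [Fintype κ] [DecidableEq κ] [Nonempty κ]
    (bF : Basis (ι ⊕ κ) K F) (bI : Basis ι K I) (hb : ∀ s, (bI s : E) = bF (Sum.inl s))
    (c : E →ₗ[K] E →ₛₗ[(τ : K →+* K)] K)
    (hI : ∀ x ∈ F, x ∈ I ↔ ∀ y ∈ F, c x y = 0) (hI' : ∀ x ∈ I, ∀ y ∈ F, c y x = 0)
    (lam : InfinitePlace K → ℝ) (hlam : ∀ v, 0 < lam v)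
    (harch : ∀ v : InfinitePlace K,
      v (Matrix.of fun i j => c (bF (Sum.inr i)) (bF (Sum.inr j))).det *
        ‖((V.restrict I).gram v bI).det‖ ≤
          lam v ^ Fintype.card κ * ‖((V.restrict F).gram v bF).det‖) :
    valueIdeal V.lattice V.isLattice.fg c ≠ 0 ∧
    (FractionalIdeal.absNorm (valueIdeal V.lattice V.isLattice.fg c) : ℝ) ^ Fintype.card κ *
      sqHeight (V.restrict I) bI ≤
        (∏ v : InfinitePlace K, lam v ^ v.mult) ^ Fintype.card κ * sqHeight (V.restrict F) bF := by
  set C : Matrix κ κ K := Matrix.of fun i j => c (bF (Sum.inr i)) (bF (Sum.inr j)) with hC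
  set J := valueIdeal V.lattice V.isLattice.fg c with hJ
  have hbI : ∀ i, (bF (Sum.inl i) : E) ∈ I := fun i => hb i ▸ (bI i).2
  have hrepr : ∀ u : F, (u : E) = ∑ i, bF.repr u (Sum.inl i) • (bF (Sum.inl i) : E) +
      ∑ k, bF.repr u (Sum.inr k) • (bF (Sum.inr k) : E) := fun u => by
    have := congrArg Subtype.val (bF.sum_repr u)
    rw [Fintype.sum_sum_type] at this
    simpa using this.symm
  -- The form on `F` depends only on the coordinates modulo its radical `I`.
  have hcF : ∀ u w : F, c u w = ∑ k, ∑ l, coordInr bF u k * C k l * τ (coordInr bF w l) := by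
    intro u w
    have h1 : c u w = c (∑ k, bF.repr u (Sum.inr k) • (bF (Sum.inr k) : E)) w := by
      conv_lhs => rw [hrepr u]
      rw [map_add, LinearMap.add_apply, (hI _ _).1 _ _ w.2, zero_add]
      · exact hIF (Submodule.sum_mem _ fun i _ => Submodule.smul_mem _ _ (hbI i))
      · exact Submodule.sum_mem _ fun i _ => Submodule.smul_mem _ _ (hbI i)
    rw [h1]
    conv_lhs => rw [hrepr w]
    rw [map_add, hI' (∑ i, bF.repr w (Sum.inl i) • (bF (Sum.inl i) : E)), zero_add]
    · simp only [map_sum, map_smul, LinearMap.sum_apply, LinearMap.smul_apply, map_smulₛₗ,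
        smul_eq_mul, Finset.mul_sum, RingEquiv.coe_toRingHom]
      rw [Finset.sum_comm]
      refine Finset.sum_congr rfl fun k _ => Finset.sum_congr rfl fun l _ => ?_
      simp only [coordInr_apply, hC, Matrix.of_apply]
      ring
    · exact Submodule.sum_mem _ fun i _ => Submodule.smul_mem _ _ (hbI i)
    · exact Submodule.sum_mem _ fun k _ => Submodule.smul_mem _ _ (bF _).2
  -- A vector in the left kernel of `C`, lifted with no component along `I`, would lie in the
  -- radical `I` and hence be zero.
  have hCdet : C.det ≠ 0 := by
    intro h0
    obtain ⟨u, hu0, hu⟩ := Matrix.exists_vecMul_eq_zero_iff.2 h0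
    set x : F := ∑ k, u k • bF (Sum.inr k) with hx
    have hxr : ∀ k, coordInr bF x k = u k := fun k => by
      rw [coordInr_apply, hx]
      simp [Finsupp.single_apply]
    have hxl : ∀ i, bF.repr x (Sum.inl i) = 0 := fun i => by
      rw [hx]; simp
    have hxI : (x : E) ∈ I := by
      rw [hI _ x.2]
      intro y hy
      have h1 := hcF x ⟨y, hy⟩
      rw [Finset.sum_comm] at h1
      rw [h1]
      refine Finset.sum_eq_zero fun l _ => ?_
      rw [← Finset.sum_mul]
      simp only [hxr]
      have : ∑ k, u k * C k l = 0 := congrFun hu l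
      rw [this, zero_mul]
    apply hu0
    have h2 : x = ∑ i, bI.repr ⟨x, hxI⟩ i • bF (Sum.inl i) := by
      apply Subtype.ext
      have := congrArg Subtype.val (bI.sum_repr ⟨x, hxI⟩)
      simp only [Submodule.coe_sum, Submodule.coe_smul, hb] at this ⊢
      exact this.symm
    ext k
    rw [← hxr, h2, coordInr_apply]
    simp
  set LF := (V.restrict F).lattice with hLF
  set Lc := LF.map ((coordInr bF).restrictScalars (𝓞 K)) with hLc
  have hLFfg : LF.FG := (V.restrict F).isLattice.fg
  -- The determinant ideal of the image of the lattice in `F / I`. It links the discriminant (`h1`)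
  -- to the ideals of `F` and `I` (`h2`).
  set cc := latticeDet Lc (hLFfg.map _) (Pi.basisFun K κ) with hcc
  have h1 : FractionalIdeal.spanSingleton (𝓞 K)⁰ C.det * (cc * twist τ cc) ≤
      J ^ Fintype.card κ := by
    refine discr_le_pow τ Lc (hLFfg.map _) (Pi.basisFun K κ) C J ?_
    rintro _ ⟨u, hu, rfl⟩ _ ⟨w, hw, rfl⟩
    have h2 := mem_valueIdeal V.lattice V.isLattice.fg c (x := u) (y := w) hu hw
    rw [hcF] at h2
    exact h2
  have h2 : (V.restrict F).detIdeal bF ≤ cc * (V.restrict I).detIdeal bI :=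
    latticeDet_le_mul LF hLFfg (V.restrict F).isLattice.span_eq_top bF (V.restrict I).lattice
      (V.restrict I).isLattice.fg (V.restrict I).isLattice.span_eq_top bI
      (Submodule.inclusion hIF) (fun i => Subtype.ext (hb i)) fun z hz => hz
  have hF0 : (V.restrict F).detIdeal bF ≠ 0 :=
    latticeDet_ne_zero LF hLFfg (V.restrict F).isLattice.span_eq_top bF
  have hcc0 : cc ≠ 0 := by
    intro h
    rw [h, zero_mul] at h2
    exact hF0 (le_antisymm h2 (FractionalIdeal.zero_le _))
  have htw0 : twist τ cc ≠ 0 := by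
    rw [Ne, ← FractionalIdeal.absNorm_eq_zero_iff, absNorm_twist,
      FractionalIdeal.absNorm_eq_zero_iff]
    exact hcc0
  have hl0 : FractionalIdeal.spanSingleton (𝓞 K)⁰ C.det * (cc * twist τ cc) ≠ 0 :=
    mul_ne_zero (FractionalIdeal.spanSingleton_ne_zero_iff.2 hCdet) (mul_ne_zero hcc0 htw0)
  have hJ0 : J ≠ 0 := by
    intro h
    rw [h, zero_pow Fintype.card_ne_zero] at h1
    exact hl0 (le_antisymm h1 (FractionalIdeal.zero_le _))
  refine ⟨hJ0, ?_⟩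
  -- Product formula: the norm of the ideal `(det C)` is the product of its archimedean absolute
  -- values, which `h5` bounds in turn.
  have h3 : (FractionalIdeal.absNorm J : ℝ) ^ Fintype.card κ ≤
      (∏ v : InfinitePlace K, v C.det ^ v.mult) * (FractionalIdeal.absNorm cc : ℝ) ^ 2 := by
    have := absNorm_le_of_le h1 hl0
    rw [map_pow, map_mul, map_mul, absNorm_twist, FractionalIdeal.absNorm_span_singleton] at this
    rw [InfinitePlace.prod_eq_abs_norm, sq]
    exact_mod_cast this
  have h4 : (FractionalIdeal.absNorm cc : ℝ) * FractionalIdeal.absNorm ((V.restrict I).detIdeal bI)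
      ≤ FractionalIdeal.absNorm ((V.restrict F).detIdeal bF) := by
    have := absNorm_le_of_le h2 hF0
    rw [map_mul] at this
    exact_mod_cast this
  have h5 : (∏ v : InfinitePlace K, v C.det ^ v.mult) *
      ∏ v : InfinitePlace K, ‖((V.restrict I).gram v bI).det‖ ^ v.mult ≤
      (∏ v : InfinitePlace K, lam v ^ v.mult) ^ Fintype.card κ *
        ∏ v : InfinitePlace K, ‖((V.restrict F).gram v bF).det‖ ^ v.mult := by
    rw [← Finset.prod_pow, ← Finset.prod_mul_distrib, ← Finset.prod_mul_distrib]
    refine Finset.prod_le_prod (fun v _ => by positivity) fun v _ => ?_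
    rw [← mul_pow, pow_right_comm, ← mul_pow]
    exact pow_le_pow_left₀ (by positivity) (harch v) _
  have hcc_nn : (0 : ℝ) ≤ FractionalIdeal.absNorm cc := by
    exact_mod_cast FractionalIdeal.absNorm_nonneg cc
  have hI_nn := (absNorm_detIdeal_pos (V.restrict I) bI).le
  have hD_nn : 0 ≤ ∏ v : InfinitePlace K, v C.det ^ v.mult :=
    Finset.prod_nonneg fun v _ => by positivity
  have hL_nn : 0 ≤ ∏ v : InfinitePlace K, lam v ^ v.mult :=
    Finset.prod_nonneg fun v _ => pow_nonneg (hlam v).le _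
  have hgI_nn : 0 ≤ ∏ v : InfinitePlace K, ‖((V.restrict I).gram v bI).det‖ ^ v.mult :=
    Finset.prod_nonneg fun v _ => by positivity
  have hgF_nn : 0 ≤ ∏ v : InfinitePlace K, ‖((V.restrict F).gram v bF).det‖ ^ v.mult :=
    Finset.prod_nonneg fun v _ => by positivity
  rw [sqHeight, sqHeight]
  set NI : ℝ := (FractionalIdeal.absNorm ((V.restrict I).detIdeal bI) : ℝ)
  set NF : ℝ := (FractionalIdeal.absNorm ((V.restrict F).detIdeal bF) : ℝ)
  set Nc : ℝ := (FractionalIdeal.absNorm cc : ℝ)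
  set gI := ∏ v : InfinitePlace K, ‖((V.restrict I).gram v bI).det‖ ^ v.mult
  set gF := ∏ v : InfinitePlace K, ‖((V.restrict F).gram v bF).det‖ ^ v.mult
  set D := ∏ v : InfinitePlace K, v C.det ^ v.mult
  calc _ ≤ (D * Nc ^ 2) * (NI ^ 2 * gI) := by gcongr
    _ = (Nc * NI) ^ 2 * (D * gI) := by ring
    _ ≤ NF ^ 2 * ((∏ v : InfinitePlace K, lam v ^ v.mult) ^ Fintype.card κ * gF) := by gcongr
    _ = _ := by ring

/-- The discriminant of a similarity with the dual bounds the height from above. -/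
theorem sqHeight_le_of_similarity (V : RigidAdelicSpace K E) {ι : Type*} [Fintype ι]
    [DecidableEq ι] (b : Basis ι K E) (c : E →ₗ[K] E →ₛₗ[(τ : K →+* K)] K)
    (lam : InfinitePlace K → ℝ)
    (hJ0 : valueIdeal V.lattice V.isLattice.fg c ≠ 0)
    (hfin : ∀ v : HeightOneSpectrum (𝓞 K),
      ∀ d ∈ valueIdeal V.lattice V.isLattice.fg c ^ Fintype.card ι, ∃ x y : ι → E,
        (∀ i, x i ∈ V.lattice) ∧ (∀ i, y i ∈ V.lattice) ∧
        v.valuation K d ≤ v.valuation K (Matrix.of fun i j => c (x i) (y j)).det)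
    (harch : ∀ v : InfinitePlace K, v (Matrix.of fun i j => c (b i) (b j)).det =
      lam v ^ Fintype.card ι * ‖(V.gram v b).det‖) :
    (∏ v : InfinitePlace K, lam v ^ v.mult) ^ Fintype.card ι * sqHeight V b ≤
      (FractionalIdeal.absNorm (valueIdeal V.lattice V.isLattice.fg c) : ℝ) ^ Fintype.card ι := by
  set C : Matrix ι ι K := Matrix.of fun i j => c (b i) (b j) with hC
  have h1 := le_discr τ V.lattice V.isLattice.fg b C _ fun v d hd => by
    obtain ⟨x, y, hx, hy, h⟩ := hfin v d hd
    refine ⟨x, y, hx, hy, h.trans_eq ?_⟩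
    congr 2
    ext i j
    exact sesq_apply c b b _ _
  have h2 := absNorm_le_of_le h1 (pow_ne_zero _ hJ0)
  rw [map_pow, map_mul, map_mul, absNorm_twist, FractionalIdeal.absNorm_span_singleton] at h2
  have h3 : (∏ v : InfinitePlace K, v C.det ^ v.mult) =
      (∏ v : InfinitePlace K, lam v ^ v.mult) ^ Fintype.card ι *
        ∏ v : InfinitePlace K, ‖(V.gram v b).det‖ ^ v.mult := by
    rw [← Finset.prod_pow, ← Finset.prod_mul_distrib]
    refine Finset.prod_congr rfl fun v _ => ?_
    rw [harch, mul_pow, pow_right_comm]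
  rw [sqHeight, mul_left_comm, ← h3, InfinitePlace.prod_eq_abs_norm, sq, detIdeal_eq_latticeDet,
    mul_comm]
  exact_mod_cast h2

/-- The destabilizing subspace is totally isotropic for a reflexive form given by a similarity
with the dual. -/
theorem isotropic_of_isDestabilizing (V : RigidAdelicSpace K E) (hV : V.IsUnstable)
    (E₁ : Submodule K E) (hE₁ : V.IsDestabilizing E₁) (c : E →ₗ[K] E →ₛₗ[(τ : K →+* K)] K)
    (hrefl : ∀ x y, c x y = 0 → c y x = 0)
    (lam : InfinitePlace K → ℝ) (hlam : ∀ v, 0 < lam v)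
    (hfin : ∀ (ι : Type) [Fintype ι] [DecidableEq ι] [Nonempty ι] (_ : Basis ι K E)
      (v : HeightOneSpectrum (𝓞 K)),
      ∀ d ∈ valueIdeal V.lattice V.isLattice.fg c ^ Fintype.card ι, ∃ x y : ι → E,
        (∀ i, x i ∈ V.lattice) ∧ (∀ i, y i ∈ V.lattice) ∧
        v.valuation K d ≤ v.valuation K (Matrix.of fun i j => c (x i) (y j)).det)
    (harch : ∀ (ι κ ρ : Type) [Fintype ι] [Fintype κ] [Fintype ρ] [DecidableEq ι]
      [DecidableEq κ] [DecidableEq ρ] (e : Basis ((ι ⊕ κ) ⊕ ρ) K E) (v : InfinitePlace K),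
      (∀ i s, c (e (Sum.inl (Sum.inl i))) (e (Sum.inl s)) = 0) →
      (∀ i s, c (e (Sum.inl s)) (e (Sum.inl (Sum.inl i))) = 0) →
      v (Matrix.of fun i j => c (e (Sum.inl (Sum.inr i))) (e (Sum.inl (Sum.inr j)))).det *
        ‖(V.gram v fun i => e (Sum.inl (Sum.inl i))).det‖ ≤
          lam v ^ Fintype.card κ * ‖(V.gram v fun i => e (Sum.inl i)).det‖ ∧
      v (Matrix.of fun i j => c (e i) (e j)).det =
        lam v ^ Fintype.card ((ι ⊕ κ) ⊕ ρ) * ‖(V.gram v e).det‖) :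
    ∀ x ∈ E₁, ∀ y ∈ E₁, c x y = 0 := by
  have := V.finite
  by_contra hne
  -- The left radical of the form on `E₁`, also its right radical by `hrefl`.
  let I : Submodule K E :=
    { carrier := {x | x ∈ E₁ ∧ ∀ y ∈ E₁, c x y = 0}
      zero_mem' := ⟨zero_mem _, fun y _ => by rw [map_zero, LinearMap.zero_apply]⟩
      add_mem' := fun {x x'} hx hx' => ⟨add_mem hx.1 hx'.1, fun y hy => by
        rw [map_add, LinearMap.add_apply, hx.2 y hy, hx'.2 y hy, add_zero]⟩
      smul_mem' := fun a x hx => ⟨E₁.smul_mem a hx.1, fun y hy => by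
        rw [map_smul, LinearMap.smul_apply, hx.2 y hy, smul_zero]⟩ }
  have hIE : I ≤ E₁ := fun x hx => hx.1
  obtain ⟨i, k, r, e, b₁, bI, hb₁, hbI⟩ := exists_adapted_basis hIE
  -- If `k = 0` then `I = E₁` and the form vanishes on `E₁`, against the assumption.
  have hk : Nonempty (Fin k) := by
    by_contra hk
    rw [not_nonempty_iff] at hk
    apply hne
    intro x hx
    have hxI : x ∈ I := by
      have h1 := congrArg Subtype.val (b₁.sum_repr ⟨x, hx⟩)
      rw [Fintype.sum_sum_type, Finset.univ_eq_empty (α := Fin k), Finset.sum_empty, add_zero] at h1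
      rw [Submodule.coe_sum] at h1
      change _ = x at h1
      rw [← h1]
      refine Submodule.sum_mem _ fun s _ => ?_
      rw [Submodule.coe_smul, hb₁, ← hbI]
      exact I.smul_mem _ (bI s).2
    exact hxI.2
  have hl : ∀ s t, c (e (Sum.inl (Sum.inl s))) (e (Sum.inl t)) = 0 := fun s t => by
    rw [← hbI, ← hb₁]; exact (bI s).2.2 _ (b₁ t).2
  have hr : ∀ s t, c (e (Sum.inl t)) (e (Sum.inl (Sum.inl s))) = 0 := fun s t => hrefl _ _ (hl s t)
  have har := fun v => harch _ _ _ e v hl hr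
  have hgI : ∀ v, (V.restrict I).gram v bI = V.gram v fun s => e (Sum.inl (Sum.inl s)) := fun v => by
    rw [restrict_gram]; simp only [hbI]
  have hg₁ : ∀ v, (V.restrict E₁).gram v b₁ = V.gram v fun s => e (Sum.inl s) := fun v => by
    rw [restrict_gram]; simp only [hb₁]
  obtain ⟨hJ0, h1⟩ := sqHeight_le_of_radical V E₁ I hIE b₁ bI (fun s => by rw [hbI, hb₁]) c
    (fun x hx => ⟨fun h => h.2, fun h => ⟨hx, h⟩⟩)
    (fun x hx y hy => hrefl _ _ (hx.2 y hy)) lam hlam (fun v => by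
      rw [hgI, hg₁]; simp only [hb₁]; exact (har v).1)
  have hne' : Nonempty ((Fin i ⊕ Fin k) ⊕ Fin r) := ⟨Sum.inl (Sum.inr hk.some)⟩
  have h2 := sqHeight_le_of_similarity V e c lam hJ0 (hfin _ e) (fun v => (har v).2)
  set J := valueIdeal V.lattice V.isLattice.fg c with hJ
  have hN : (0 : ℝ) < FractionalIdeal.absNorm J := by
    exact_mod_cast lt_of_le_of_ne (FractionalIdeal.absNorm_nonneg _)
      (Ne.symm (FractionalIdeal.absNorm_eq_zero_iff.not.2 hJ0))
  set Λ := ∏ v : InfinitePlace K, lam v ^ v.mult with hΛ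
  have hΛ0 : 0 < Λ := Finset.prod_pos fun v _ => pow_pos (hlam v) _
  have h1' := Real.log_le_log (mul_pos (pow_pos hN _) (sqHeight_pos _ bI)) h1
  have h2' := Real.log_le_log (mul_pos (pow_pos hΛ0 _) (sqHeight_pos _ e)) h2
  rw [Real.log_mul (pow_pos hN _).ne' (sqHeight_pos _ bI).ne',
    Real.log_mul (pow_pos hΛ0 _).ne' (sqHeight_pos _ b₁).ne', Real.log_pow, Real.log_pow,
    log_sqHeight, log_sqHeight] at h1'
  rw [Real.log_mul (pow_pos hΛ0 _).ne' (sqHeight_pos _ e).ne', Real.log_pow, Real.log_pow,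
    log_sqHeight] at h2'
  have hk0 : (0 : ℝ) < Fintype.card (Fin k) := by exact_mod_cast Fintype.card_pos
  have hm0 : (0 : ℝ) < Fintype.card (Fin i ⊕ Fin k) := by
    have : Nonempty (Fin i ⊕ Fin k) := ⟨Sum.inr hk.some⟩
    exact_mod_cast Fintype.card_pos
  have hn0 : (0 : ℝ) < Fintype.card ((Fin i ⊕ Fin k) ⊕ Fin r) := by
    exact_mod_cast Fintype.card_pos
  have hm : (Fintype.card (Fin i ⊕ Fin k) : ℝ) = Fintype.card (Fin i) + Fintype.card (Fin k) := by
    rw [Fintype.card_sum]; push_cast; ring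
  have hd : (0 : ℝ) < finrank ℚ K := by exact_mod_cast finrank_pos
  -- instability
  have h3 : Real.log (V.restrict E₁).height / Fintype.card (Fin i ⊕ Fin k) <
      Real.log V.height / Fintype.card ((Fin i ⊕ Fin k) ⊕ Fin r) := by
    rw [← log_reducedHeight _ b₁, ← log_reducedHeight _ e]
    refine Real.log_lt_log (reducedHeight_pos _ b₁) ?_
    rw [RigidAdelicSpace.IsUnstable, RigidAdelicSpace.IsSemistable] at hV
    push Not at hV
    obtain ⟨F, hF0, hF⟩ := hV
    exact (hE₁.2.1 F hF0).trans_lt hF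
  -- minimality
  have h4 : Fintype.card (Fin i) *
      (Real.log (V.restrict E₁).height / Fintype.card (Fin i ⊕ Fin k)) ≤
        Real.log (V.restrict I).height := by
    by_cases hi : IsEmpty (Fin i)
    · rw [height_eq_one_of_isEmpty _ bI, Fintype.card_eq_zero]; simp
    · rw [not_isEmpty_iff] at hi
      have hi0 : (0 : ℝ) < Fintype.card (Fin i) := by exact_mod_cast Fintype.card_pos
      have hIbot : I ≠ ⊥ := by
        intro h
        have h5 := bI.ne_zero hi.some
        apply h5
        apply Subtype.ext
        exact (Submodule.mem_bot K).1 (h ▸ (bI hi.some).2)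
      have h6 := Real.log_le_log (reducedHeight_pos _ b₁) (hE₁.2.1 I hIbot)
      rw [log_reducedHeight _ b₁, log_reducedHeight _ bI, le_div_iff₀ hi0] at h6
      linarith
  set a₁ := Real.log (V.restrict E₁).height with ha₁
  set aI := Real.log (V.restrict I).height
  set aE := Real.log V.height
  set k' : ℝ := (Fintype.card (Fin k) : ℝ)
  set m' : ℝ := (Fintype.card (Fin i ⊕ Fin k) : ℝ)
  set n' : ℝ := (Fintype.card ((Fin i ⊕ Fin k) ⊕ Fin r) : ℝ)
  set i' : ℝ := (Fintype.card (Fin i) : ℝ)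
  set d' : ℝ := (finrank ℚ K : ℝ)
  -- The quantity to squeeze: `h7` bounds it below by `2 d'` times the log of the reduced height of
  -- `E`, and `h6` above by the same expression for `E₁`.
  set s := Real.log (FractionalIdeal.absNorm J : ℝ) - Real.log Λ with hs
  set μ := a₁ / m' with hμ
  have ha₁' : a₁ = m' * μ := by rw [hμ]; field_simp
  have h5 : k' * s ≤ k' * (2 * d' * μ) := by
    -- Since `a₁ = m' μ`, `aI ≥ i' μ` and `m' = i' + k'`.
    have : 2 * d' * (a₁ - aI) ≤ 2 * d' * (k' * μ) := by
      refine mul_le_mul_of_nonneg_left ?_ (by positivity)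
      rw [ha₁', hm]; linarith
    rw [hs]; linarith
  have h6 : s ≤ 2 * d' * μ := le_of_mul_le_mul_left h5 hk0
  have h7 : 2 * d' * (aE / n') ≤ s := by
    have : n' * (2 * d' * (aE / n')) = 2 * d' * aE := by field_simp
    refine le_of_mul_le_mul_left ?_ hn0
    rw [this, hs]; linarith
  have h8 : 2 * d' * μ < 2 * d' * (aE / n') := mul_lt_mul_of_pos_left h3 (by positivity)
  linarith

end Destabilizing

/-! ### The isodual and anti-isodual cases -/

section Pairings

open scoped ComplexOrder Matrix

variable {K E : Type*} [Field K] [NumberField K] [AddCommGroup E] [Module K E]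
  [Module (𝓞 K) E] [IsScalarTower (𝓞 K) K E]

omit [NumberField K] in
theorem infinitePlace_det {κ : Type*} [Fintype κ] [DecidableEq κ] (v : InfinitePlace K)
    (C : Matrix κ κ K) : v C.det = ‖(C.map v.embedding).det‖ := by
  rw [← InfinitePlace.norm_embedding_eq, RingHom.map_det]; rfl

/-- The determinant estimates at an infinite place for a form on a rigid adelic space. -/
theorem arch_bounds_form (V : RigidAdelicSpace K E) {ι κ ρ : Type*} [Fintype ι] [Fintype κ]
    [Fintype ρ] [DecidableEq ι] [DecidableEq κ] [DecidableEq ρ]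
    (e : Basis ((ι ⊕ κ) ⊕ ρ) K E) (v : InfinitePlace K) (B : E → E → K) (lam : ℝ)
    (hlam : 0 < lam) (P : Matrix ((ι ⊕ κ) ⊕ ρ) ((ι ⊕ κ) ⊕ ρ) ℂ)
    (hP : P = V.gram v e ∨ P = (V.gram v e)ᵀ)
    (h : ∀ w, herm (formMatrix v e B * (V.gram v e)⁻¹ * (formMatrix v e B)ᴴ) w w =
      ((lam ^ 2 : ℝ) : ℂ) * herm P w w)
    (hl : ∀ i s, B (e (Sum.inl (Sum.inl i))) (e (Sum.inl s)) = 0)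
    (hr : ∀ i s, B (e (Sum.inl s)) (e (Sum.inl (Sum.inl i))) = 0) :
    v (Matrix.of fun i j => B (e (Sum.inl (Sum.inr i))) (e (Sum.inl (Sum.inr j)))).det *
        ‖(V.gram v fun i => e (Sum.inl (Sum.inl i))).det‖ ≤
          lam ^ Fintype.card κ * ‖(V.gram v fun i => e (Sum.inl i)).det‖ ∧
      v (Matrix.of fun i j => B (e i) (e j)).det =
        lam ^ Fintype.card ((ι ⊕ κ) ⊕ ρ) * ‖(V.gram v e).det‖ := by
  rw [infinitePlace_det, infinitePlace_det]
  refine arch_bounds (V.gram v e) P (formMatrix v e B) _ lam hlam (gram_posDef V v e) hP h ?_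
  ext (i | i) (j | j)
  · simp [Matrix.toBlocks₁₁, formMatrix, hl]
  · simp [Matrix.toBlocks₁₁, formMatrix, hl]
  · simp [Matrix.toBlocks₁₁, formMatrix, hr]
  · simp [Matrix.toBlocks₁₁, formMatrix]

theorem eq_zero_of_archNorm_eq_zero (V : RigidAdelicSpace K E) (v : InfinitePlace K) (x : E)
    (h : V.toAdelicData.archNorm v (1 ⊗ₜ x) = 0) : x = 0 := by
  by_contra hx
  have h1 : (1 : v.Completion) ⊗ₜ[K] x ≠ 0 := fun h0 =>
    hx (Module.FaithfullyFlat.tensorProduct_mk_injective (A := K) (B := v.Completion) E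
      (h0.trans (TensorProduct.tmul_zero _ _).symm))
  exact (Real.sqrt_pos.2 (V.form_pos v _ h1)).ne' h

omit [NumberField K] [Module (𝓞 K) E] [IsScalarTower (𝓞 K) K E] in
theorem dual_archNorm_zero (A : AdelicData K E) (v : InfinitePlace K) :
    A.dual.archNorm v 0 = 0 := by
  change sSup {r : ℝ | _} = 0
  apply le_antisymm
  · refine Real.sSup_nonpos ?_
    rintro _ ⟨X, -, rfl⟩
    simp
  · refine Real.sSup_nonneg ?_
    rintro _ ⟨X, -, rfl⟩
    simp

/-- The duality pairing. -/
def dualPairing (K E : Type*) [Field K] [AddCommGroup E] [Module K E] :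
    Dual K E →ₗ[K] E →ₛₗ[((RingEquiv.refl K : K ≃+* K) : K →+* K)] K where
  toFun φ :=
    { toFun := φ
      map_add' := map_add φ
      map_smul' := fun a x => φ.map_smul a x }
  map_add' _ _ := rfl
  map_smul' _ _ := rfl

variable (K) in
/-- Complex conjugation on a CM field. -/
def conjEquiv [IsCMField K] : K ≃+* K := (IsCMField.complexConj K).toRingEquiv

theorem conjEquiv_apply [IsCMField K] (a : K) : conjEquiv K a = IsCMField.complexConj K a := rfl

/-- The conjugate of the pairing with the conjugate dual. -/
def conjDualPairing (K E : Type*) [Field K] [NumberField K] [IsCMField K] [AddCommGroup E]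
    [Module K E] : Conj K (Dual K E) →ₗ[K] E →ₛₗ[(conjEquiv K : K →+* K)] K where
  toFun φ :=
    { toFun := fun x => conjEquiv K (Conj.out K φ x)
      map_add' := fun x y => by rw [map_add, map_add]
      map_smul' := fun a x => by rw [map_smul, smul_eq_mul, map_mul]; rfl }
  map_add' φ ψ := by
    ext x
    change conjEquiv K (Conj.out K (φ + ψ) x) = conjEquiv K _ + conjEquiv K _
    rw [map_add, LinearMap.add_apply, map_add]
  map_smul' a φ := by
    ext x
    change conjEquiv K (Conj.out K (a • φ) x) = a * conjEquiv K (Conj.out K φ x)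
    rw [Conj.out_smul, LinearMap.smul_apply, smul_eq_mul, map_mul, conjEquiv_apply,
      IsCMField.complexConj_apply_apply]

/-- The case where `τ` is the identity. A similarity is not required to be injective by definition;
injectivity follows from definiteness of the norm at any infinite place. -/
theorem isotropic_of_isIsodual (V : RigidAdelicSpace K E) (hV : V.IsUnstable) (E₁ : Submodule K E)
    (hE₁ : V.IsDestabilizing E₁) (σ : E →ₗ[K] Dual K E) (hσ : V.IsIsodual σ)
    (hrefl : ∀ x y, σ x y = 0 → σ y x = 0) :
    (∀ x ∈ E₁, ∀ y ∈ E₁, σ x y = 0) ∧ 2 * finrank K E₁ ≤ finrank K E := by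
  have := V.finite
  obtain ⟨ratioFin, lam, hFpos, hlam, -, hfin, harch⟩ := hσ
  have hinj : ∀ x, dualPairing K E (σ x) = 0 → x = 0 := fun x hx => by
    have hσx : σ x = 0 := LinearMap.ext fun y => LinearMap.congr_fun hx y
    obtain ⟨v⟩ : Nonempty (InfinitePlace K) := inferInstance
    have h1 := harch v (1 ⊗ₜ x)
    rw [LinearMap.baseChange_tmul, hσx, TensorProduct.tmul_zero, dual_archNorm_zero] at h1
    exact eq_zero_of_archNorm_eq_zero V v x
      ((mul_eq_zero.1 h1.symm).resolve_left (hlam v).ne')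
  have hiso := isotropic_of_isDestabilizing V hV E₁ hE₁ ((dualPairing K E).comp σ) hrefl lam hlam
    (fun ι _ _ _ b v => exists_valuation_le_det V.lattice V.isLattice.fg V.isLattice.span_eq_top b
      V.toAdelicData V.toAdelicData.dual rfl (dualPairing K E) (fun _ => Iff.rfl) σ hinj v
      (ratioFin v) (hFpos v) fun x => by rw [← hfin, LinearMap.baseChange_tmul])
    (fun ι κ ρ _ _ _ _ _ _ e v hl hr => arch_bounds_form V e v (fun x y => σ x y) (lam v) (hlam v)
      _ (Or.inr rfl) (herm_eq_of_isodual V v e σ (lam v) (harch v)) hl hr)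
  exact ⟨hiso, two_mul_finrank_le ((dualPairing K E).comp σ) hinj E₁ hiso⟩

/-- The form `b_σ` is antilinear in its first variable. Its complex conjugate `c` is linear in the
first and antilinear in the second, as in the general argument. Conjugation preserves zeros,
integrality and the absolute values at the infinite places, so the results carry over. -/
theorem isotropic_of_isAntiIsodual [IsCMField K] (V : RigidAdelicSpace K E) (hV : V.IsUnstable) (E₁ : Submodule K E)
    (hE₁ : V.IsDestabilizing E₁) (σ : E →ₗ[K] Conj K (Dual K E))
    (hσ : V.IsAntiIsodual σ) (hrefl : ∀ x y, sesqForm σ x y = 0 → sesqForm σ y x = 0) :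
    (∀ x ∈ E₁, ∀ y ∈ E₁, sesqForm σ x y = 0) ∧ 2 * finrank K E₁ ≤ finrank K E := by
  have := V.finite
  obtain ⟨ratioFin, lam, hFpos, hlam, -, hfin, harch⟩ := hσ
  set c := (conjDualPairing K E).comp σ with hc
  have hcσ : ∀ x y, c x y = conjEquiv K (sesqForm σ x y) := fun _ _ => rfl
  have hc0 : ∀ x y, c x y = 0 ↔ sesqForm σ x y = 0 := fun x y => by
    rw [hcσ, map_eq_zero_iff _ (conjEquiv K).injective]
  have hinj : ∀ x, c x = 0 → x = 0 := fun x hx => by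
    have hσx : σ x = 0 := (Conj.out K).injective (LinearMap.ext fun y =>
      (hc0 x y).1 (LinearMap.congr_fun hx y))
    obtain ⟨v⟩ : Nonempty (InfinitePlace K) := inferInstance
    have h1 := harch v (1 ⊗ₜ x)
    rw [LinearMap.baseChange_tmul, hσx, TensorProduct.tmul_zero] at h1
    have h2 : V.toAdelicData.dual.conj.archNorm v 0 = 0 := by
      change V.toAdelicData.dual.archNorm v (conjTensor K (Dual K E) v 0) = 0
      rw [map_zero, dual_archNorm_zero]
    rw [h2] at h1
    exact eq_zero_of_archNorm_eq_zero V v x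
      ((mul_eq_zero.1 h1.symm).resolve_left (hlam v).ne')
  have hmem : ∀ a : K, conjEquiv K a ∈ (algebraMap (𝓞 K) K).range ↔
      a ∈ (algebraMap (𝓞 K) K).range := fun a => by
    constructor
    · rintro ⟨r, hr⟩
      refine ⟨RingOfIntegers.mapRingEquiv (conjEquiv K).symm r, ?_⟩
      rw [← symm_algebraMap, hr, RingEquiv.symm_apply_apply]
    · rintro ⟨r, rfl⟩
      exact ⟨RingOfIntegers.mapRingEquiv (conjEquiv K) r, rfl⟩
  have hiso := isotropic_of_isDestabilizing V hV E₁ hE₁ c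
    (fun x y h => (hc0 y x).2 (hrefl x y ((hc0 x y).1 h))) lam hlam
    (fun ι _ _ _ b v => exists_valuation_le_det V.lattice V.isLattice.fg V.isLattice.span_eq_top b
      V.toAdelicData V.toAdelicData.dual.conj rfl (conjDualPairing K E)
      (fun φ => forall₂_congr fun x _ => (hmem (Conj.out K φ x)).symm) σ hinj v
      (ratioFin v) (hFpos v) fun x => by rw [← hfin, LinearMap.baseChange_tmul])
    (fun ι κ ρ _ _ _ _ _ _ e v hl hr => by
      have hdet : ∀ {α : Type} [Fintype α] [DecidableEq α] (f : α → E),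
          v (Matrix.of fun i j => c (f i) (f j)).det =
            v (Matrix.of fun i j => sesqForm σ (f i) (f j)).det := fun {α} _ _ f => by
        have : (Matrix.of fun i j => c (f i) (f j)) =
          (conjEquiv K : K →+* K).mapMatrix (Matrix.of fun i j => sesqForm σ (f i) (f j)) := rfl
        rw [this, ← RingHom.map_det]
        exact IsCMField.infinitePlace_complexConj K v _
      rw [hdet e, hdet fun i => e (Sum.inl (Sum.inr i))]
      exact arch_bounds_form V e v (fun x y => sesqForm σ x y) (lam v) (hlam v)
        _ (Or.inl rfl) (herm_eq_of_antiIsodual V v e σ (lam v) (harch v))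
        (fun i s => (hc0 _ _).1 (hl i s)) (fun i s => (hc0 _ _).1 (hr i s)))
  exact ⟨fun x hx y hy => (hc0 x y).1 (hiso x hx y hy), two_mul_finrank_le c hinj E₁ hiso⟩

end Pairings

end AdelicSpace
end
theorem corollary4p3 {K : Type*} [Field K] [NumberField K]
    {E : Type*} [AddCommGroup E] [Module K E] [Module (𝓞 K) E] [IsScalarTower (𝓞 K) K E]
    (V : AdelicSpace.RigidAdelicSpace K E) (hV : V.IsUnstable)
    (E₁ : Submodule K E) (hE₁ : V.IsDestabilizing E₁) :
    (∀ σ : E →ₗ[K] Module.Dual K E, V.IsIsodual σ →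
      AdelicSpace.IsOrthogonal (AdelicSpace.bilinForm σ) ∨
        AdelicSpace.IsSymplectic (AdelicSpace.bilinForm σ) →
      AdelicSpace.IsTotallyIsotropic (AdelicSpace.bilinForm σ) E₁ ∧
        2 * Module.finrank K E₁ ≤ Module.finrank K E) ∧
    (∀ [IsCMField K] (σ : E →ₗ[K] AdelicSpace.Conj K (Module.Dual K E)), V.IsAntiIsodual σ →
      AdelicSpace.IsUnitary (AdelicSpace.sesqForm σ) ∨
        AdelicSpace.IsSkewUnitary (AdelicSpace.sesqForm σ) →
      AdelicSpace.IsTotallyIsotropic (AdelicSpace.sesqForm σ) E₁ ∧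
        2 * Module.finrank K E₁ ≤ Module.finrank K E) := by
  refine ⟨fun σ hσ htype => AdelicSpace.isotropic_of_isIsodual V hV E₁ hE₁ σ hσ ?_,
    fun σ hσ htype => AdelicSpace.isotropic_of_isAntiIsodual V hV E₁ hE₁ σ hσ ?_⟩
  · intro x y hxy
    rcases htype with h | h
    · exact (h y x).trans hxy
    -- Polarization: an alternating form is antisymmetric, hence reflexive.
    · have h1 : σ (x + y) (x + y) = 0 := h (x + y)
      have hx : σ x x = 0 := h x
      have hy : σ y y = 0 := h y
      simpa [hx, hy, hxy] using h1
  · intro x y hxy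
    rcases htype with h | h
    · rw [h x y, hxy, map_zero]
    · rw [h x y, hxy, map_zero, neg_zero]
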